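/- Let $\Gamma\subset\mathbb{R}^3$ be a compact smooth surface without boundary, given as the regular zero level set of its signed distance function $d$, which is smooth on an open set $U\supset\Gamma$, negative in the interior and positive in the exterior of $\Gamma$. Put $\nu=\nabla d$ and $\xi(x)=x-d(x)\nu(x)$ for $x\in U$. Let $q\ge 0$ be an integer and $\sigma>0$. A mesh is a finite conforming triangulation $\mathcal{T}_h$ of a closed polyhedral surface $\Gamma_h=\bigcup_{K_h\in\mathcal{T}_h}K_h\subset U$ by non-degenerate planar triangles, such that all vertices lie on $\Gamma$, every edge belongs to exactly two triangles, $\xi:\Gamma_h\to\Gamma$ is a bijection, and each $K_h\in\mathcal{T}_h$ contains, in its own plane, a disc of radius $r>0$ with $\operatorname{diam}K_h\le\sigma r$; let $h=\max_{K_h\in\mathcal{T}_h}\operatorname{diam}K_h$. If $K_h^+,K_h^-\in\mathcal{T}_h$ share the edge $e_h$, the conormal $n_h^{\pm}$ is the unit vector parallel to the plane of $K_h^{\pm}$ with $n_h^{\pm}\cdot(y-x)\le 0$ for all $x\in e_h$, $y\in K_h^{\pm}$, and the average conormal is $n_{e_h}^{+}=\frac{\frac12(n_h^+-n_h^-)}{|\frac12(n_h^+-n_h^-)|}$.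 Let $K$ be the reference triangle and $F_{K_h}:K\to K_h$ the affine bijection, with $\nabla F_{K_h}=(e_0,e_1)$ where $e_0,e_1$ are the edge vectors of $K_h$ issuing from the vertex $x_0$. Let $\mathbb{P}_{RT}^{q}(K_h)$ be the set of all fields $(\nabla F_{K_h}\,p)\circ F_{K_h}^{-1}$ with $p\in[\mathbb{P}^q(K)]^2$ (so $\mathbb{P}_{RT}^{-1}(K_h)=\{0\}$), and $$RT^q(K_h)=\{\,s_h(x)+(x-x_0)\,t(F_{K_h}^{-1}(x)) : s_h\in\mathbb{P}_{RT}^{q}(K_h),\ t\in\mathbb{P}^q(K)\,\}.$$ For a vector field $w$ on $\Gamma$ put $w^{-l}=w\circ\xi$ on $\Gamma_h$. The local surface Raviart–Thomas interpolant $\Pi_{K_h}^q w^{-l}\in RT^q(K_h)$ on $K_h=K_h^+$ is defined by $$\int_{e_h}\Pi_{K_h}^q w^{-l}\cdot n_h^+\,p_q\,\mathrm{d}s_h=\int_{e_h}w^{-l}\cdot n_{e_h}^+\,p_q\,\mathrm{d}s_h\quad\forall p_q\in\mathbb{P}^q(e_h),\ e_h\subset\partial K_h,$$ $$\int_{K_h}\Pi_{K_h}^q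 w^{-l}\cdot\mathbf{p}_{q-1}\,\mathrm{d}A_h=\int_{K_h}w^{-l}\cdot\mathbf{p}_{q-1}\,\mathrm{d}A_h\quad\forall\mathbf{p}_{q-1}\in\mathbb{P}_{RT}^{q-1}(K_h),$$ and the local classical Raviart–Thomas interpolant $\widetilde\Pi_{K_h}^q w^{-l}\in RT^q(K_h)$ is defined by the same conditions with $n_{e_h}^+$ replaced by $n_h^+$. Then there is a constant $C$, depending only on $\Gamma$ (with $U$ and $d$), $\sigma$ and $q$, and not on the mesh, such that for every mesh, every tangential vector field $w$ on $\Gamma$ ($w\cdot\nu=0$) with $w^{-l}\in[W^{1,\infty}(\Gamma_h)]^3$ (identified with its continuous representative), and every $K_h\in\mathcal{T}_h$, $$\big\|\Pi_{K_h}^q w^{-l}-\widetilde\Pi_{K_h}^q w^{-l}\big\|_{L^\infty(K_h\cup\partial K_h)}\le C\,\|w\|_{L^\infty(\Gamma)}\,h^2 .$$ -/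

import Mathlib

open Set MeasureTheory
open scoped ContDiff

noncomputable section

namespace SurfaceRT

/-- Ambient Euclidean space. -/
abbrev E3 : Type := EuclideanSpace ℝ (Fin 3)

/-! ### The smooth surface -/

/-- `Γ` is a compact smooth surface without boundary, given as the (regular) zero level set of its
signed distance function `d`, which is defined and smooth on the open set `U`, negative in the
interior of `Γ` and positive in its exterior. -/
structure IsSmoothSurface (Γ U : Set E3) (d : E3 → ℝ) : Prop where
  isCompact : IsCompact Γ
  isOpen : IsOpen U
  subset : Γ ⊆ U
  smooth : ContDiffOn ℝ ∞ d U
  abs_eq_dist : ∀ x ∈ U, |d x| = Metric.infDist x Γ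
  zeroSet : Γ = {x ∈ U | d x = 0}
  regular : ∀ x ∈ Γ, gradient d x ≠ 0
  interior_exterior : ∃ Ω : Set E3, IsOpen Ω ∧ Bornology.IsBounded Ω ∧ frontier Ω = Γ ∧
    ∀ x ∈ U, (x ∈ Ω ↔ d x < 0)

/-- The projection `ξ(x) = x - d(x) ν(x)` onto the surface, with `ν = ∇d` on `U`. -/
def proj (d : E3 → ℝ) (x : E3) : E3 := x - d x • gradient d x

/-- The inverse surface lift `w^{-l} = w ∘ ξ` of a vector field `w` given on `Γ`. -/
def invLift (d : E3 → ℝ) (w : E3 → E3) (x : E3) : E3 := w (proj d x)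

/-! ### The discrete surface -/

/-- The triangles of a simplicial complex, as sets of three vertices. -/
def triangles (𝒯 : Geometry.SimplicialComplex ℝ E3) : Set (Finset E3) :=
  {s | s ∈ 𝒯.faces ∧ s.card = 3}

/-- The closed planar triangle (or edge) with vertex set `s`. -/
abbrev hull (s : Finset E3) : Set E3 := convexHull ℝ (s : Set E3)

/-- The mesh size: the largest diameter of a triangle. -/
def meshSize (𝒯 : Geometry.SimplicialComplex ℝ E3) : ℝ :=
  sSup ((fun s => Metric.diam (hull s)) '' triangles 𝒯)

/-- The triangle with vertex set `s` contains a disc (in its own plane) whose radius is at least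
`1/σ` times the diameter of the triangle. -/
def ShapeRegular (σ : ℝ) (s : Finset E3) : Prop :=
  ∃ c ∈ hull s, ∃ r : ℝ, 0 < r ∧ Metric.diam (hull s) ≤ σ * r ∧
    Metric.closedBall c r ∩ (affineSpan ℝ (s : Set E3) : Set E3) ⊆ hull s

/-- `𝒯` is a regular (with shape-regularity constant `σ`) conforming triangulation of a closed
polyhedral surface `Γ_h = 𝒯.space ⊆ U` which interpolates `Γ` linearly: the vertices lie on `Γ`, and
the projection `ξ` is a bijection from `Γ_h` onto `Γ`. Conformity is part of
`Geometry.SimplicialComplex`. -/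
structure IsSurfaceMesh (Γ U : Set E3) (d : E3 → ℝ) (σ : ℝ)
    (𝒯 : Geometry.SimplicialComplex ℝ E3) : Prop where
  finite : 𝒯.faces.Finite
  pure : ∀ s ∈ 𝒯.faces, ∃ t ∈ triangles 𝒯, s ⊆ t
  two_triangles : ∀ e ∈ 𝒯.faces, e.card = 2 → {s ∈ triangles 𝒯 | e ⊆ s}.ncard = 2
  shapeRegular : ∀ s ∈ triangles 𝒯, ShapeRegular σ s
  vertices : ∀ s ∈ 𝒯.faces, (s : Set E3) ⊆ Γ
  subset : 𝒯.space ⊆ U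
  bijOn : BijOn (proj d) 𝒯.space Γ

/-- `n` is the conormal of the triangle `K` on its edge `e`: a unit vector, tangential to `K`, with
`n · (y - x) ≤ 0` for all `x ∈ e` and `y ∈ K`. -/
structure IsConormal (n : E3) (K e : Set E3) : Prop where
  unit : ‖n‖ = 1
  tangential : n ∈ vectorSpan ℝ K
  outward : ∀ x ∈ e, ∀ y ∈ K, inner ℝ n (y - x) ≤ 0

/-- The average conormal `½(n⁺ - n⁻) / |½(n⁺ - n⁻)|`. -/
def avgConormal (np nm : E3) : E3 :=
  ‖(1 / 2 : ℝ) • (np - nm)‖⁻¹ • ((1 / 2 : ℝ) • (np - nm))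

/-! ### Reference element, integrals -/

/-- The closed reference triangle. -/
def refTriangle : Set (Fin 2 → ℝ) := {y | 0 ≤ y 0 ∧ 0 ≤ y 1 ∧ y 0 + y 1 ≤ 1}

/-- The open reference triangle. -/
def refInterior : Set (Fin 2 → ℝ) := {y | 0 < y 0 ∧ 0 < y 1 ∧ y 0 + y 1 < 1}

/-- The affine map `F_K` from the reference triangle onto the triangle with vertices
`v 0, v 1, v 2`. -/
def refMap (v : Fin 3 → E3) (y : Fin 2 → ℝ) : E3 :=
  v 0 + y 0 • (v 1 - v 0) + y 1 • (v 2 - v 0)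

/-- `∇F_K p = p₀ e₀ + p₁ e₁`, with the edges `e₀ = v 1 - v 0` and `e₁ = v 2 - v 0`. -/
def gradRefMap (v : Fin 3 → E3) (p : Fin 2 → ℝ) : E3 :=
  p 0 • (v 1 - v 0) + p 1 • (v 2 - v 0)

/-- The line integral of `f` over the segment from `a` to `b`; the integrand is given
as a function of the point and of the parameter `t ∈ [0, 1]`. -/
def edgeIntegral (a b : E3) (f : E3 → ℝ → ℝ) : ℝ :=
  ‖b - a‖ * ∫ t in (0 : ℝ)..1, f (AffineMap.lineMap a b t) t

/-- The surface integral of `f` over the triangle with vertices `v`; the integrand is given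
as a function of the point `F_K(y)` and of the reference coordinates `y`. The factor in front is
the square root of the Gram determinant of `F_K`. -/
def triangleIntegral (v : Fin 3 → E3) (f : E3 → (Fin 2 → ℝ) → ℝ) : ℝ :=
  Real.sqrt (‖v 1 - v 0‖ ^ 2 * ‖v 2 - v 0‖ ^ 2 - inner ℝ (v 1 - v 0) (v 2 - v 0) ^ 2) *
    ∫ y in refTriangle, f (refMap v y) y

/-! ### The space `W^{1,∞}(Γ_h)` -/

/-- `g` is the weak `i`-th partial derivative of `u` on the open reference triangle. -/
def IsWeakPartial (i : Fin 2) (u g : (Fin 2 → ℝ) → E3) : Prop :=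
  ∀ φ : (Fin 2 → ℝ) → ℝ, ContDiff ℝ ∞ φ → HasCompactSupport φ → tsupport φ ⊆ refInterior →
    ∫ y in refInterior, (fderiv ℝ φ y (Pi.single i 1)) • u y = - ∫ y in refInterior, φ y • g y

/-- `W^{1,∞}` on the open reference triangle. -/
def MemW1InfRef (u : (Fin 2 → ℝ) → E3) : Prop :=
  MemLp u ⊤ (volume.restrict refInterior) ∧
    ∀ i : Fin 2, ∃ g : (Fin 2 → ℝ) → E3,
      MemLp g ⊤ (volume.restrict refInterior) ∧ IsWeakPartial i u g

/-- `f ∈ [W^{1,∞}(Γ_h)]³`: `f`, identified with its continuous representative (so that it has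
values on edges), is in `W^{1,∞}` of each triangle. -/
def MemW1Inf (𝒯 : Geometry.SimplicialComplex ℝ E3) (f : E3 → E3) : Prop :=
  ContinuousOn f 𝒯.space ∧
    ∀ v : Fin 3 → E3, Function.Injective v → Finset.univ.image v ∈ triangles 𝒯 →
      MemW1InfRef (fun y => f (refMap v y))

/-! ### Raviart–Thomas spaces and interpolants -/

/-- Value of a pair of polynomials in two variables at the reference point `y`. -/
def evalPair (p : Fin 2 → MvPolynomial (Fin 2) ℝ) (y : Fin 2 → ℝ) : Fin 2 → ℝ :=
  fun j => MvPolynomial.eval y (p j)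

/-- `ψ`, restricted to the triangle `K` with vertices `v`, belongs to the local Raviart–Thomas
space `RT^q(K)`: at `x = F_K(y)` it is `∇F_K p(y) + (x - x₀) t(y)` with `p ∈ [ℙ^q]²`, `t ∈ ℙ^q`. -/
def MemRT (q : ℕ) (v : Fin 3 → E3) (ψ : E3 → E3) : Prop :=
  ∃ (p : Fin 2 → MvPolynomial (Fin 2) ℝ) (t : MvPolynomial (Fin 2) ℝ),
    (∀ j, (p j).totalDegree ≤ q) ∧ t.totalDegree ≤ q ∧
    ∀ y ∈ refTriangle, ψ (refMap v y) =
      gradRefMap v (evalPair p y) + MvPolynomial.eval y t • (refMap v y - v 0)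

/-- Equality of the interior moments of `ψ` and `f` against `ℙ_RT^{q-1}(K)`
(no condition if `q = 0`). -/
def InteriorMomentsEq (q : ℕ) (v : Fin 3 → E3) (ψ f : E3 → E3) : Prop :=
  ∀ p : Fin 2 → MvPolynomial (Fin 2) ℝ, (∀ j, (p j).totalDegree < q) →
    triangleIntegral v (fun x y => inner ℝ (ψ x) (gradRefMap v (evalPair p y))) =
      triangleIntegral v (fun x y => inner ℝ (f x) (gradRefMap v (evalPair p y)))

/-- On the segment from `a` to `b`, the moments of `ψ · n` and of `f · m` against `ℙ^q` agree. -/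
def EdgeMomentsEq (q : ℕ) (a b : E3) (ψ : E3 → E3) (n : E3) (f : E3 → E3) (m : E3) : Prop :=
  ∀ p : Polynomial ℝ, p.natDegree ≤ q →
    edgeIntegral a b (fun x t => inner ℝ (ψ x) n * p.eval t) =
      edgeIntegral a b (fun x t => inner ℝ (f x) m * p.eval t)

/-- `ψ` is, on the triangle `K` with vertices `v`, the local classical Raviart–Thomas interpolant of
order `q` of `f`. The edge with index `i` has the end points `v (i + 1)`, `v (i + 2)`. -/
def IsClassicalRTInterpolant (q : ℕ) (v : Fin 3 → E3) (f ψ : E3 → E3) : Prop :=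
  MemRT q v ψ ∧ InteriorMomentsEq q v ψ f ∧
    ∀ (i : Fin 3) (n : E3),
      IsConormal n (convexHull ℝ (range v)) (segment ℝ (v (i + 1)) (v (i + 2))) →
      EdgeMomentsEq q (v (i + 1)) (v (i + 2)) ψ n f n

/-- `ψ` is, on the triangle `K⁺` of `𝒯` with vertices `v`, the local surface Raviart–Thomas
interpolant of order `q` of `f`: on the edge shared with the neighbour `K⁻`, the conormal `n⁺` is
replaced by the average conormal on the right-hand side. -/
def IsSurfaceRTInterpolant (𝒯 : Geometry.SimplicialComplex ℝ E3) (q : ℕ) (v : Fin 3 → E3)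
    (f ψ : E3 → E3) : Prop :=
  MemRT q v ψ ∧ InteriorMomentsEq q v ψ f ∧
    ∀ (i : Fin 3), ∀ s ∈ triangles 𝒯, s ≠ Finset.univ.image v → v (i + 1) ∈ s → v (i + 2) ∈ s →
      ∀ np nm : E3,
      IsConormal np (convexHull ℝ (range v)) (segment ℝ (v (i + 1)) (v (i + 2))) →
      IsConormal nm (hull s) (segment ℝ (v (i + 1)) (v (i + 2))) →
      EdgeMomentsEq q (v (i + 1)) (v (i + 2)) ψ np f (avgConormal np nm)

end SurfaceRT

end

namespace SurfaceRT

/-! The difference of the two interpolants is a Raviart–Thomas field whose interior moments vanish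
and whose edge moments are those of `w^{-l} · (n_e - n⁺)`. The estimate therefore splits into a
stability bound for such fields and a pointwise bound `O(h²)` for this product.

Stability. A Raviart–Thomas field on the triangle is `∇F` applied to a reference field `p + y t`. On
the reference triangle the edge moments are injective on fields without interior moments
(`ref_unisolvent`), so they have a linear left inverse, and this yields a sup bound with a constant
depending only on `q` (`exists_ref_bound`). Passing to the triangle, a normal component picks up the
height over the edge, which is at least the inradius `r` (`abs_refEdgeMoment_sub_le`), while the
columns of `∇F` have length at most `σ r`. The powers of `r` cancel.

Geometry. The identity `d ∇d = x - p` for a nearest point `p` makes `ξ` the nearest point projection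
and places `x` on the normal line at `ξ(x)`. Bounded second derivatives of `d` make the unit normal
Lipschitz and secants tangential to second order, so planes of shape-regular triangles with vertices
on `Γ` deviate from the tangent planes by `κ = O(h)` (`NormalBound.abs_inner_le`). The conormals
`n⁺` and `n⁻` on a common edge are thus almost parallel or almost opposite. The first case would be
a fold, in which a short normal line meets both triangles, against injectivity of `ξ`
(`inner_conormal_nonpos`). In the second case `n⁺ + n⁻` is `O(κ²)` in the plane of `K⁺` and `O(κ)`
along the normal of this plane; a tangential `w` has a component of size only `O(κ)` along that
normal, so `w · (n⁺ + n⁻)` is `O(κ²)` (`abs_inner_avgConormal_sub_le`). On coarse meshes the trivial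
bound `2 ‖w‖` suffices. -/

/-! ### Bivariate polynomials vanishing on a line -/

open MvPolynomial in
/-- Division with remainder of a bivariate polynomial by `X j - r`. -/
lemma exists_sub_aeval_update_eq_mul (j : Fin 2) (r : MvPolynomial (Fin 2) ℝ)
    (hr : r.totalDegree ≤ 1) (n : ℕ) (P : MvPolynomial (Fin 2) ℝ) (hP : P.totalDegree ≤ n + 1) :
    ∃ Q : MvPolynomial (Fin 2) ℝ, Q.totalDegree ≤ n ∧
      P - aeval (Function.update X j r) P = (X j - r) * Q := by
  have key : ∀ m ∈ P.support, ∃ Q : MvPolynomial (Fin 2) ℝ, Q.totalDegree ≤ n ∧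
      monomial m (P.coeff m) - aeval (Function.update X j r) (monomial m (P.coeff m))
        = (X j - r) * Q := by
    intro m hm
    obtain ⟨k, hk⟩ : ∃ k : Fin 2, k ≠ j := exists_ne j
    have hdeg : m j + m k ≤ n + 1 := by
      have := (le_totalDegree hm).trans hP
      rw [Finsupp.sum_fintype _ _ (by simp), Fin.sum_univ_two] at this
      fin_cases j <;> fin_cases k <;> simp_all
      omega
    have hprod : ∀ g : Fin 2 → MvPolynomial (Fin 2) ℝ,
        (m.prod fun i e => g i ^ e) = g j ^ m j * g k ^ m k := by
      intro g
      rw [Finsupp.prod_fintype _ _ (by simp), Fin.prod_univ_two]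
      fin_cases j <;> fin_cases k <;> simp_all [mul_comm]
    rcases Nat.eq_zero_or_pos (m j) with h0 | h0
    · refine ⟨0, by simp, ?_⟩
      rw [aeval_monomial, monomial_eq, hprod, hprod, h0]
      simp [Function.update_of_ne hk]
    -- The quotient of `X j ^ m j - r ^ m j` by `X j - r` is a geometric sum, of degree at most `m j
    -- - 1` because `r` is affine.
    · refine ⟨C (P.coeff m) * X k ^ m k *
        ∑ i ∈ Finset.range (m j), X j ^ i * r ^ (m j - 1 - i), ?_, ?_⟩
      · refine (totalDegree_mul _ _).trans ?_
        have h1 : (C (P.coeff m) * X k ^ m k : MvPolynomial (Fin 2) ℝ).totalDegree ≤ m k := by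
          refine (totalDegree_mul _ _).trans ?_
          rw [totalDegree_C, totalDegree_X_pow, zero_add]
        have h2 : (∑ i ∈ Finset.range (m j),
            (X j ^ i * r ^ (m j - 1 - i) : MvPolynomial (Fin 2) ℝ)).totalDegree ≤ m j - 1 := by
          refine (totalDegree_finsetSum _ _).trans (Finset.sup_le fun i hi => ?_)
          refine (totalDegree_mul _ _).trans ?_
          rw [totalDegree_X_pow]
          have := (totalDegree_pow r (m j - 1 - i)).trans (Nat.mul_le_mul_left _ hr)
          rw [Finset.mem_range] at hi
          omega
        omega
      · rw [aeval_monomial, monomial_eq, hprod, hprod, Function.update_self,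
          Function.update_of_ne hk]
        have := (Commute.all (X j : MvPolynomial (Fin 2) ℝ) r).mul_geom_sum₂ (m j)
        rw [algebraMap_eq]
        linear_combination (-(C (P.coeff m) * X k ^ m k)) * this
  choose! Q hQ using key
  refine ⟨∑ m ∈ P.support, Q m, ?_, ?_⟩
  · exact (totalDegree_finsetSum _ _).trans (Finset.sup_le fun m hm => (hQ m hm).1)
  · rw [Finset.mul_sum, ← Finset.sum_congr rfl fun m hm => (hQ m hm).2, Finset.sum_sub_distrib,
      ← map_sum, support_sum_monomial_coeff]

open MvPolynomial in
/-- A polynomial of degree at most `n` which vanishes on a line is divisible by the equation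
of the line. -/
lemma exists_eq_mul_of_aeval_update_eq_zero (j : Fin 2) (r : MvPolynomial (Fin 2) ℝ)
    (hr : r.totalDegree ≤ 1) (n : ℕ) (P : MvPolynomial (Fin 2) ℝ) (hP : P.totalDegree ≤ n)
    (h0 : aeval (Function.update X j r) P = 0) :
    ∃ Q : MvPolynomial (Fin 2) ℝ, (Q = 0 ∨ Q.totalDegree < n) ∧ P = (X j - r) * Q := by
  cases n with
  -- `totalDegree` of the zero polynomial is `0`, so for `n = 0` the zero quotient is not covered by
  -- the strict degree bound.
  | zero =>
    refine ⟨0, Or.inl rfl, ?_⟩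
    rw [Nat.le_zero, totalDegree_eq_zero_iff_eq_C] at hP
    rw [hP] at h0 ⊢
    simpa [algebraMap_eq] using h0
  | succ n =>
    obtain ⟨Q, hQ, h⟩ := exists_sub_aeval_update_eq_mul j r hr n P hP
    exact ⟨Q, Or.inr (by omega), by rw [← h, h0, sub_zero]⟩

/-! ### Moments and unisolvence on the reference triangle -/

/-- The point with parameter `t` on the edge of the reference triangle opposite to the vertex
with index `i`. -/
def refEdge (i : Fin 3) (t : ℝ) : Fin 2 → ℝ :=
  (![![1 - t, t], ![0, 1 - t], ![t, 0]] : Fin 3 → Fin 2 → ℝ) i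

/-- Outward normals (not normalized) of the reference triangle. -/
def refNormal (i : Fin 3) : Fin 2 → ℝ :=
  (![![1, 1], ![-1, 0], ![0, -1]] : Fin 3 → Fin 2 → ℝ) i

open Polynomial in
/-- `refEdge` as a pair of univariate polynomials. -/
noncomputable def refEdgePoly (i : Fin 3) : Fin 2 → ℝ[X] :=
  (![![1 - X, X], ![0, 1 - X], ![X, 0]] : Fin 3 → Fin 2 → ℝ[X]) i

lemma eval_refEdgePoly (i : Fin 3) (j : Fin 2) (t : ℝ) :
    (refEdgePoly i j).eval t = refEdge i t j := by
  fin_cases i <;> fin_cases j <;> simp [refEdgePoly, refEdge]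

lemma natDegree_refEdgePoly_le (i : Fin 3) (j : Fin 2) : (refEdgePoly i j).natDegree ≤ 1 := by
  have h : (1 - Polynomial.X : Polynomial ℝ).natDegree ≤ 1 :=
    (Polynomial.natDegree_sub_le _ _).trans (by simp)
  fin_cases i <;> fin_cases j <;> simp [refEdgePoly, h]

lemma eval_aeval_refEdgePoly (i : Fin 3) (P : MvPolynomial (Fin 2) ℝ) (t : ℝ) :
    (MvPolynomial.aeval (refEdgePoly i) P).eval t = MvPolynomial.eval (refEdge i t) P := by
  rw [← Polynomial.coe_aeval_eq_eval, ← MvPolynomial.aeval_eq_eval]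
  change ((Polynomial.aeval t).comp (MvPolynomial.aeval (refEdgePoly i))) P = _
  rw [MvPolynomial.comp_aeval]
  congr 2
  funext j
  rw [Polynomial.coe_aeval_eq_eval, eval_refEdgePoly]

lemma natDegree_aeval_refEdgePoly_le (i : Fin 3) (P : MvPolynomial (Fin 2) ℝ) :
    (MvPolynomial.aeval (refEdgePoly i) P).natDegree ≤ P.totalDegree := by
  rw [MvPolynomial.aeval_def, MvPolynomial.eval₂_eq]
  refine Polynomial.natDegree_sum_le_of_forall_le _ _ fun m hm => ?_
  refine Polynomial.natDegree_mul_le.trans ?_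
  rw [Polynomial.algebraMap_apply, Polynomial.natDegree_C, zero_add]
  refine (Polynomial.natDegree_prod_le _ _).trans ?_
  refine le_trans (Finset.sum_le_sum fun j _ => (Polynomial.natDegree_pow_le_of_le (m j)
    (natDegree_refEdgePoly_le i j))) ?_
  simpa [Finsupp.sum] using MvPolynomial.le_totalDegree hm

lemma continuous_refEdge (i : Fin 3) : Continuous (refEdge i) := by
  refine continuous_pi fun j => ?_
  simp_rw [← eval_refEdgePoly]
  exact Polynomial.continuous _

lemma refEdge_mem (i : Fin 3) {t : ℝ} (ht : t ∈ Icc (0 : ℝ) 1) : refEdge i t ∈ refTriangle := by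
  obtain ⟨h0, h1⟩ := ht
  fin_cases i <;> simp [refEdge, refTriangle] <;> constructor <;> linarith

/-- A polynomial of degree at most `q` all of whose moments up to order `q` vanish is zero. -/
lemma polynomial_eq_zero_of_moments (q : ℕ) (P : Polynomial ℝ) (hP : P.natDegree ≤ q)
    (h : ∀ k ≤ q, ∫ t in (0 : ℝ)..1, P.eval t * t ^ k = 0) : P = 0 := by
  have h2 : ∫ t in (0 : ℝ)..1, P.eval t * P.eval t = 0 := by
    have : ∀ t : ℝ, P.eval t * P.eval t =
        ∑ k ∈ Finset.range (q + 1), P.coeff k * (P.eval t * t ^ k) := by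
      intro t
      nth_rw 2 [Polynomial.eval_eq_sum_range' (Nat.lt_succ_of_le hP)]
      rw [Finset.mul_sum]
      exact Finset.sum_congr rfl fun k _ => by ring
    simp_rw [this]
    rw [intervalIntegral.integral_finsetSum]
    · refine Finset.sum_eq_zero fun k hk => ?_
      rw [intervalIntegral.integral_const_mul, h k (by simpa [Nat.lt_succ_iff] using hk), mul_zero]
    · intro k _
      exact (Continuous.intervalIntegrable (by fun_prop) _ _)
  have hz : ∀ t ∈ Icc (0 : ℝ) 1, P.eval t = 0 := by
    by_contra! hne
    obtain ⟨c, hc, hc0⟩ := hne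
    have := intervalIntegral.integral_pos (f := fun t => P.eval t * P.eval t)
      (zero_lt_one (α := ℝ)) (by fun_prop) (fun t _ => mul_self_nonneg _)
      ⟨c, hc, mul_self_pos.2 hc0⟩
    exact absurd h2 this.ne'
  exact Polynomial.eq_zero_of_infinite_isRoot P
    ((Icc_infinite (zero_lt_one (α := ℝ))).mono hz)

/-- Edge moments of a pair of polynomials on the reference triangle. -/
noncomputable def refEdgeMoment (Φ : Fin 2 → MvPolynomial (Fin 2) ℝ) (i : Fin 3) (k : ℕ) : ℝ :=
  ∫ t in (0 : ℝ)..1, (∑ j, MvPolynomial.eval (refEdge i t) (Φ j) * refNormal i j) * t ^ k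

lemma continuous_edge_integrand (Φ : Fin 2 → MvPolynomial (Fin 2) ℝ) (i : Fin 3) (k : ℕ) :
    Continuous fun t : ℝ =>
      (∑ j, MvPolynomial.eval (refEdge i t) (Φ j) * refNormal i j) * t ^ k := by
  have : ∀ j, Continuous fun t : ℝ => MvPolynomial.eval (refEdge i t) (Φ j) := fun j =>
    (MvPolynomial.continuous_eval (Φ j)).comp (continuous_refEdge i)
  fun_prop

/-- `P` vanishes on the edge with index `i` if its moments there vanish. -/
lemma eval_refEdge_eq_zero_of_moments (q : ℕ) (i : Fin 3) (P : MvPolynomial (Fin 2) ℝ)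
    (hP : P.totalDegree ≤ q)
    (h : ∀ k ≤ q, ∫ t in (0 : ℝ)..1, MvPolynomial.eval (refEdge i t) P * t ^ k = 0) (t : ℝ) :
    MvPolynomial.eval (refEdge i t) P = 0 := by
  rw [← eval_aeval_refEdgePoly, polynomial_eq_zero_of_moments q _
    ((natDegree_aeval_refEdgePoly_le i P).trans hP), Polynomial.eval_zero]
  intro k hk
  simpa only [eval_aeval_refEdgePoly] using h k hk

lemma isCompact_refTriangle : IsCompact refTriangle := by
  refine (isCompact_Icc (a := (0 : Fin 2 → ℝ)) (b := 1)).of_isClosed_subset ?_ ?_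
  · refine IsClosed.inter (isClosed_le continuous_const (continuous_apply 0))
      (IsClosed.inter (isClosed_le continuous_const (continuous_apply 1))
        (isClosed_le ((continuous_apply 0).add (continuous_apply 1)) continuous_const))
  · rintro y ⟨h0, h1, h2⟩
    refine ⟨fun j => ?_, fun j => ?_⟩ <;> fin_cases j <;> simp <;> linarith

lemma isOpen_refInterior : IsOpen refInterior :=
  IsOpen.inter (isOpen_lt continuous_const (continuous_apply 0))
    (IsOpen.inter (isOpen_lt continuous_const (continuous_apply 1))
      (isOpen_lt ((continuous_apply 0).add (continuous_apply 1)) continuous_const))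

lemma refInterior_subset : refInterior ⊆ refTriangle :=
  fun _ h => ⟨h.1.le, h.2.1.le, h.2.2.le⟩

/-- A polynomial which vanishes on the open reference triangle is zero. -/
lemma mvPolynomial_eq_zero_of_refInterior (P : MvPolynomial (Fin 2) ℝ)
    (h : ∀ y ∈ refInterior, MvPolynomial.eval y P = 0) : P = 0 := by
  refine MvPolynomial.funext_set (fun _ => Ioo (0 : ℝ) (1 / 2))
    (fun _ => Ioo_infinite (by norm_num)) fun y hy => ?_
  have h0 := hy 0 (mem_univ _)
  have h1 := hy 1 (mem_univ _)
  rw [map_zero]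
  exact h y ⟨h0.1, h1.1, by linarith [h0.2, h1.2]⟩

open MvPolynomial in
/-- Unisolvence of the Raviart–Thomas element on the reference triangle. -/
lemma ref_unisolvent (q : ℕ) (p : Fin 2 → MvPolynomial (Fin 2) ℝ) (t : MvPolynomial (Fin 2) ℝ)
    (hp : ∀ j, (p j).totalDegree ≤ q) (ht : t.totalDegree ≤ q)
    (hint : ∀ u : Fin 2 → MvPolynomial (Fin 2) ℝ, (∀ j, (u j).totalDegree < q) →
      ∫ y in refTriangle, ∑ j, eval y (p j + X j * t) * eval y (u j) = 0)
    (hedge : ∀ i, ∀ k ≤ q, refEdgeMoment (fun j => p j + X j * t) i k = 0) (j : Fin 2) :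
    p j + X j * t = 0 := by
  -- Since `y · n` is constant along an edge, the normal component of `p + y t` agrees there with a
  -- polynomial of degree `q` rather than `q + 1`, so moments up to order `q` determine it.
  have htri : ∀ i, ∀ P : MvPolynomial (Fin 2) ℝ, P.totalDegree ≤ q →
      (∀ s, ∑ j, eval (refEdge i s) (p j + X j * t) * refNormal i j = eval (refEdge i s) P) →
      ∀ s, eval (refEdge i s) P = 0 := by
    intro i P hP hs
    refine eval_refEdge_eq_zero_of_moments q i P hP fun k hk => ?_
    simpa only [refEdgeMoment, hs] using hedge i k hk
  have e0 := htri 0 (p 0 + p 1 + t) (by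
      refine (totalDegree_add _ _).trans (max_le ((totalDegree_add _ _).trans
        (max_le (hp 0) (hp 1))) ht)) (fun s => by
      simp [refEdge, refNormal, Fin.sum_univ_two]; ring)
  have e1 := htri 1 (-p 0) (by rw [totalDegree_neg]; exact hp 0) (fun s => by
      simp [refEdge, refNormal, Fin.sum_univ_two])
  have e2 := htri 2 (-p 1) (by rw [totalDegree_neg]; exact hp 1) (fun s => by
      simp [refEdge, refNormal, Fin.sum_univ_two])
  have haeval : ∀ (j : Fin 2) (r P : MvPolynomial (Fin 2) ℝ) (y : Fin 2 → ℝ),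
      eval y (aeval (Function.update X j r) P) = eval (Function.update y j (eval y r)) P := by
    intro j r P y
    rw [← aeval_eq_eval, ← aeval_eq_eval]
    change ((aeval y).comp (aeval (Function.update X j r))) P = _
    rw [comp_aeval]
    congr 2
    funext i
    rcases eq_or_ne i j with rfl | hij
    · simp
    · simp [hij]
  obtain ⟨ρ₀, hρ₀, h0⟩ := exists_eq_mul_of_aeval_update_eq_zero 0 0 (by simp) q (p 0) (hp 0) (by
    refine MvPolynomial.funext fun y => ?_
    simp only [haeval, map_zero]
    have := e1 (1 - y 1)
    rw [map_neg, neg_eq_zero] at this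
    convert this using 3
    funext i; fin_cases i <;> simp [refEdge])
  obtain ⟨ρ₁, hρ₁, h1⟩ := exists_eq_mul_of_aeval_update_eq_zero 1 0 (by simp) q (p 1) (hp 1) (by
    refine MvPolynomial.funext fun y => ?_
    simp only [haeval, map_zero]
    have := e2 (y 0)
    rw [map_neg, neg_eq_zero] at this
    convert this using 3
    funext i; fin_cases i <;> simp [refEdge])
  obtain ⟨η, hη, h2⟩ := exists_eq_mul_of_aeval_update_eq_zero 1 (1 - X 0)
    ((totalDegree_sub _ _).trans (by simp)) q (p 0 + p 1 + t)
    ((totalDegree_add _ _).trans (max_le ((totalDegree_add _ _).trans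
        (max_le (hp 0) (hp 1))) ht)) (by
    refine MvPolynomial.funext fun y => ?_
    rw [haeval, map_zero]
    have := e0 (1 - y 0)
    convert this using 3
    funext i; fin_cases i <;> simp [refEdge])
  rw [sub_zero] at h0 h1
  have hdeg : ∀ a b : MvPolynomial (Fin 2) ℝ, (a = 0 ∨ a.totalDegree < q) →
      (b = 0 ∨ b.totalDegree < q) → a - b = 0 ∨ (a - b).totalDegree < q := by
    rintro a b (rfl | ha) (rfl | hb)
    · simp
    · right; rwa [zero_sub, totalDegree_neg]
    · right; rwa [sub_zero]
    · right; exact (totalDegree_sub _ _).trans_lt (max_lt ha hb)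
  -- With `p j = y j * ρ j` and `t = -(y 0 * ρ₀ + y 1 * ρ₁ + (1 - y 0 - y 1) * η)`, testing against
  -- `ρ j - η` turns the integrand into squares weighted by the barycentric coordinates.
  have hI : ∫ y in refTriangle, ∑ j, eval y (p j + X j * t) *
      eval y ((![ρ₀ - η, ρ₁ - η] : Fin 2 → MvPolynomial (Fin 2) ℝ) j) = 0 := by
    have hu0 := hdeg _ _ hρ₀ hη
    have hu1 := hdeg _ _ hρ₁ hη
    rcases Nat.eq_zero_or_pos q with rfl | hq
    · simp only [not_lt_zero, or_false] at hu0 hu1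
      simp [hu0, hu1]
    · refine hint _ fun j => ?_
      fin_cases j
      · rcases hu0 with h | h <;> simp [h, hq]
      · rcases hu1 with h | h <;> simp [h, hq]
  -- The integrand is a sum of nonnegative terms.
  set F : (Fin 2 → ℝ) → ℝ := fun y => y 0 * eval y (ρ₀ + t) ^ 2 + y 1 * eval y (ρ₁ + t) ^ 2 +
    (1 - y 0 - y 1) * eval y (η + t) ^ 2 with hF
  have hFeq : ∀ y : Fin 2 → ℝ, ∑ j, eval y (p j + X j * t) *
      eval y ((![ρ₀ - η, ρ₁ - η] : Fin 2 → MvPolynomial (Fin 2) ℝ) j) = F y := by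
    intro y
    have h2' := congrArg (eval y) h2
    rw [h0, h1] at h2'
    simp only [map_add, map_sub, map_mul, eval_X, map_one] at h2'
    simp only [hF, Fin.sum_univ_two, h0, h1, map_add, map_sub, map_mul, eval_X,
      Matrix.cons_val_zero, Matrix.cons_val_one]
    linear_combination (-(eval y t + eval y η)) * h2'
  have hFc : Continuous F := by
    have := fun P : MvPolynomial (Fin 2) ℝ => continuous_eval P
    fun_prop
  simp_rw [hFeq] at hI
  have hzero : ∀ y ∈ refInterior, F y = 0 := by
    have hae := (setIntegral_eq_zero_iff_of_nonneg_ae (μ := volume) (s := refTriangle) (f := F)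
      ((ae_restrict_iff' isCompact_refTriangle.measurableSet).2 (Filter.Eventually.of_forall
        fun y hy => by
          have h3 : 0 ≤ 1 - y 0 - y 1 := by linarith [hy.2.2]
          have := hy.1
          have := hy.2.1
          simp only [hF, Pi.zero_apply]; positivity))
      (hFc.continuousOn.integrableOn_compact isCompact_refTriangle)).1 hI
    have hae' := ae_restrict_of_ae_restrict_of_subset refInterior_subset hae
    intro y hy
    exact (Measure.eqOn_open_of_ae_eq hae' isOpen_refInterior hFc.continuousOn
      continuousOn_const) hy
  have hvan : ∀ y ∈ refInterior, eval y (ρ₀ + t) = 0 ∧ eval y (ρ₁ + t) = 0 := by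
    intro y hy
    have h := hzero y hy
    obtain ⟨ha, hb, hc⟩ := hy
    have hc' : 0 < 1 - y 0 - y 1 := by linarith
    simp only [hF] at h
    have t0 : 0 ≤ y 0 * eval y (ρ₀ + t) ^ 2 := by positivity
    have t1 : 0 ≤ y 1 * eval y (ρ₁ + t) ^ 2 := by positivity
    have t2 : 0 ≤ (1 - y 0 - y 1) * eval y (η + t) ^ 2 := by positivity
    constructor
    · have : y 0 * eval y (ρ₀ + t) ^ 2 = 0 := by linarith
      simpa [ha.ne'] using this
    · have : y 1 * eval y (ρ₁ + t) ^ 2 = 0 := by linarith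
      simpa [hb.ne'] using this
  have z0 := mvPolynomial_eq_zero_of_refInterior _ fun y hy => (hvan y hy).1
  have z1 := mvPolynomial_eq_zero_of_refInterior _ fun y hy => (hvan y hy).2
  fin_cases j
  · simp only [Fin.zero_eta, h0]; rw [← mul_add, z0, mul_zero]
  · simp only [Fin.mk_one, h1]; rw [← mul_add, z1, mul_zero]

/-! ### Stability bound on the reference triangle -/

open MvPolynomial in
/-- The fields of the reference Raviart–Thomas space whose interior moments vanish. -/
noncomputable def refBubbleFree (q : ℕ) : Submodule ℝ (Fin 2 → MvPolynomial (Fin 2) ℝ) where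
  carrier := {Φ | (∃ (p : Fin 2 → MvPolynomial (Fin 2) ℝ) (t : MvPolynomial (Fin 2) ℝ),
    (∀ j, (p j).totalDegree ≤ q) ∧ t.totalDegree ≤ q ∧ ∀ j, Φ j = p j + X j * t) ∧
    ∀ u : Fin 2 → MvPolynomial (Fin 2) ℝ, (∀ j, (u j).totalDegree < q) →
      ∫ y in refTriangle, ∑ j, eval y (Φ j) * eval y (u j) = 0}
  zero_mem' := ⟨⟨0, 0, by simp, by simp, by simp⟩, by simp⟩
  add_mem' := by
    rintro Φ Ψ ⟨⟨p, t, hp, ht, hΦ⟩, hu⟩ ⟨⟨p', t', hp', ht', hΨ⟩, hu'⟩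
    refine ⟨⟨p + p', t + t', fun j => (totalDegree_add _ _).trans (max_le (hp j) (hp' j)),
      (totalDegree_add _ _).trans (max_le ht ht'), fun j => ?_⟩, fun u h => ?_⟩
    · simp only [Pi.add_apply, hΦ, hΨ]; ring
    · have hc := fun P : MvPolynomial (Fin 2) ℝ => continuous_eval P
      have hadd := congrArg₂ (· + ·) (hu u h) (hu' u h)
      simp only [add_zero] at hadd
      rw [← hadd, ← integral_add]
      · simp only [Pi.add_apply, map_add, add_mul, Finset.sum_add_distrib]
      · exact ContinuousOn.integrableOn_compact isCompact_refTriangle (by fun_prop)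
      · exact ContinuousOn.integrableOn_compact isCompact_refTriangle (by fun_prop)
  smul_mem' := by
    rintro c Φ ⟨⟨p, t, hp, ht, hΦ⟩, hu⟩
    refine ⟨⟨c • p, c • t, fun j => (totalDegree_smul_le _ _).trans (hp j),
      (totalDegree_smul_le _ _).trans ht, fun j => ?_⟩, fun u h => ?_⟩
    · simp only [Pi.smul_apply, hΦ, smul_add, mul_smul_comm]
    · rw [← mul_zero c, ← hu u h, ← integral_const_mul]
      simp only [Pi.smul_apply, smul_eval, Finset.mul_sum, mul_assoc]

/-- Edge moments up to order `q` as a linear map. -/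
noncomputable def refEdgeMomentMap (q : ℕ) :
    refBubbleFree q →ₗ[ℝ] (Fin 3 × Fin (q + 1) → ℝ) where
  toFun Φ a := refEdgeMoment Φ.1 a.1 a.2
  map_add' Φ Ψ := by
    funext a
    simp only [refEdgeMoment, Pi.add_apply]
    rw [← intervalIntegral.integral_add
      ((continuous_edge_integrand _ _ _).intervalIntegrable _ _)
      ((continuous_edge_integrand _ _ _).intervalIntegrable _ _)]
    simp only [Submodule.coe_add, Pi.add_apply, map_add, add_mul, Finset.sum_add_distrib]
  map_smul' c Φ := by
    funext a
    simp only [refEdgeMoment, Pi.smul_apply, smul_eq_mul, RingHom.id_apply]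
    rw [← intervalIntegral.integral_const_mul]
    simp only [Submodule.coe_smul, Pi.smul_apply, MvPolynomial.smul_eval, mul_assoc,
      ← Finset.mul_sum]

lemma refEdgeMomentMap_injective (q : ℕ) : Function.Injective (refEdgeMomentMap q) := by
  rw [← LinearMap.ker_eq_bot, LinearMap.ker_eq_bot']
  rintro ⟨Φ, ⟨p, t, hp, ht, hΦ⟩, hu⟩ h
  obtain rfl : Φ = fun j => p j + MvPolynomial.X j * t := funext hΦ
  refine Subtype.ext (funext fun j => ?_)
  refine ref_unisolvent q p t hp ht hu (fun i k hk => ?_) j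
  exact congrFun h (i, ⟨k, Nat.lt_succ_of_le hk⟩)

/-- On the reference triangle, a Raviart–Thomas field without interior moments is bounded by its
edge moments. -/
lemma exists_ref_bound (q : ℕ) : ∃ C : ℝ, ∀ Φ ∈ refBubbleFree q, ∀ G : ℝ,
    (∀ i, ∀ k ≤ q, |refEdgeMoment Φ i k| ≤ G) →
    ∀ y ∈ refTriangle, ∀ j, |MvPolynomial.eval y (Φ j)| ≤ C * G := by
  classical
  -- The left inverse sends each unit vector of moments to a fixed polynomial field, bounded on the
  -- compact triangle; the sum of these bounds is the constant.
  obtain ⟨g, hg⟩ := (refEdgeMomentMap q).exists_leftInverse_of_injective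
    (LinearMap.ker_eq_bot.2 (refEdgeMomentMap_injective q))
  have hb : ∀ (a : Fin 3 × Fin (q + 1)) (j : Fin 2), ∃ c : ℝ, 0 ≤ c ∧ ∀ y ∈ refTriangle,
      |MvPolynomial.eval y ((g (Pi.single a 1)).1 j)| ≤ c := by
    intro a j
    obtain ⟨c, hc⟩ := isCompact_refTriangle.exists_bound_of_continuousOn
      (MvPolynomial.continuous_eval ((g (Pi.single a 1)).1 j)).continuousOn
    exact ⟨max c 0, le_max_right _ _, fun y hy => (hc y hy).trans (le_max_left _ _)⟩
  choose c hc0 hc using hb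
  refine ⟨∑ a, ∑ j, c a j, ?_⟩
  intro Φ hΦ G hG y hy j
  have hG0 : 0 ≤ G := (abs_nonneg _).trans (hG 0 0 (Nat.zero_le _))
  have hexp : (⟨Φ, hΦ⟩ : refBubbleFree q) =
      ∑ a, refEdgeMoment Φ a.1 a.2 • g (Pi.single a 1) := by
    have h1 : g (refEdgeMomentMap q ⟨Φ, hΦ⟩) = ⟨Φ, hΦ⟩ := LinearMap.congr_fun hg _
    rw [← h1]
    nth_rw 1 [pi_eq_sum_univ' (refEdgeMomentMap q ⟨Φ, hΦ⟩)]
    rw [map_sum]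
    refine Finset.sum_congr rfl fun a _ => ?_
    rw [map_smul]
    simp only [refEdgeMomentMap, LinearMap.coe_mk, AddHom.coe_mk]
  have hval : MvPolynomial.eval y (Φ j) =
      ∑ a, refEdgeMoment Φ a.1 a.2 * MvPolynomial.eval y ((g (Pi.single a 1)).1 j) := by
    have h2 := congrArg (fun Ψ : refBubbleFree q => MvPolynomial.eval y (Ψ.1 j)) hexp
    simpa [Finset.sum_apply, map_sum, MvPolynomial.smul_eval] using h2
  rw [hval, Finset.sum_mul]
  refine (Finset.abs_sum_le_sum_abs _ _).trans (Finset.sum_le_sum fun a _ => ?_)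
  rw [abs_mul, mul_comm]
  refine mul_le_mul ?_ (hG _ _ (Nat.lt_succ_iff.1 a.2.2)) (abs_nonneg _)
    (Finset.sum_nonneg fun j _ => hc0 a j)
  exact (hc a j y hy).trans (Finset.single_le_sum (f := c a) (fun j _ => hc0 a j)
    (Finset.mem_univ j))

/-! ### Geometry of the signed distance function -/

namespace IsSmoothSurface

variable {Γ U : Set E3} {d : E3 → ℝ}

lemma differentiableAt (h : IsSmoothSurface Γ U d) {x : E3} (hx : x ∈ U) :
    DifferentiableAt ℝ d x :=
  ((h.smooth.differentiableOn (by simp)) x hx).differentiableAt (h.isOpen.mem_nhds hx)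

lemma inner_gradient (x v : E3) : inner ℝ (gradient d x) v = fderiv ℝ d x v := by
  rw [gradient, InnerProductSpace.toDual_symm_apply]

lemma norm_gradient (x : E3) : ‖gradient d x‖ = ‖fderiv ℝ d x‖ := by
  rw [gradient, LinearIsometryEquiv.norm_map]

lemma continuousOn_gradient (h : IsSmoothSurface Γ U d) : ContinuousOn (gradient d) U :=
  (InnerProductSpace.toDual ℝ E3).symm.continuous.comp_continuousOn
    (h.smooth.continuousOn_fderiv_of_isOpen h.isOpen (by simp))

lemma dist_zero (h : IsSmoothSurface Γ U d) {p : E3} (hp : p ∈ Γ) : d p = 0 := by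
  rw [h.zeroSet] at hp; exact hp.2

/-- The gradient of a signed distance function is at most one. -/
lemma norm_gradient_le_one (h : IsSmoothSurface Γ U d) {x : E3} (hx : x ∈ U) :
    ‖gradient d x‖ ≤ 1 := by
  rw [norm_gradient]
  have hlip : ∀ y, |Metric.infDist y Γ - Metric.infDist x Γ| ≤ ‖y - x‖ := fun y => by
    rw [← Real.dist_eq, ← dist_eq_norm]
    simpa using (Metric.lipschitz_infDist_pt Γ).dist_le_mul y x
  have hU := h.isOpen.mem_nhds hx
  have hc : ContinuousAt d x := (h.differentiableAt hx).continuousAt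
  rw [← NNReal.coe_one]
  refine (h.differentiableAt hx).hasFDerivAt.le_of_lip' (by simp) ?_
  -- Away from the zero set `d` is locally plus or minus the 1-Lipschitz function `infDist`; at a
  -- zero the identity for `|d|` is enough.
  rcases lt_trichotomy (d x) 0 with hd | hd | hd
  · filter_upwards [hU, hc.eventually (gt_mem_nhds hd)] with y hy hyd
    have := hlip y
    rw [← h.abs_eq_dist y hy, ← h.abs_eq_dist x hx, abs_of_neg hyd, abs_of_neg hd] at this
    rw [Real.norm_eq_abs, abs_sub_comm]
    simpa [neg_add_eq_sub] using this
  · filter_upwards [hU] with y hy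
    have := hlip y
    rw [← h.abs_eq_dist y hy, ← h.abs_eq_dist x hx, hd, abs_zero, sub_zero, abs_abs] at this
    simpa [hd] using this
  · filter_upwards [hU, hc.eventually (lt_mem_nhds hd)] with y hy hyd
    have := hlip y
    rw [← h.abs_eq_dist y hy, ← h.abs_eq_dist x hx, abs_of_pos hyd, abs_of_pos hd] at this
    simpa using this

/-- Along the segment to a nearest point, the distance decreases linearly. -/
lemma infDist_segment {p x : E3} (hp : p ∈ Γ) (hpx : Metric.infDist x Γ = ‖x - p‖) {t : ℝ}
    (ht : t ∈ Icc (0 : ℝ) 1) :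
    Metric.infDist (p + t • (x - p)) Γ = t * ‖x - p‖ := by
  refine le_antisymm ?_ ?_
  · refine (Metric.infDist_le_dist_of_mem hp).trans_eq ?_
    rw [dist_eq_norm, add_sub_cancel_left, norm_smul, Real.norm_of_nonneg ht.1]
  · have h1 : Metric.infDist x Γ ≤ Metric.infDist (p + t • (x - p)) Γ + dist x (p + t • (x - p)) :=
      Metric.infDist_le_infDist_add_dist
    have h2 : dist x (p + t • (x - p)) = (1 - t) * ‖x - p‖ := by
      rw [dist_eq_norm, ← Real.norm_of_nonneg (sub_nonneg.2 ht.2), ← norm_smul]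
      congr 1; module
    rw [h2, hpx] at h1
    linarith

/-- `d ∇d` is the vector from a nearest point on the surface. -/
lemma smul_gradient_eq (h : IsSmoothSurface Γ U d) {x p : E3} (hx : x ∈ U) (hp : p ∈ Γ)
    (hpx : Metric.infDist x Γ = ‖x - p‖) : d x • gradient d x = x - p := by
  have habs := h.abs_eq_dist x hx
  rw [hpx] at habs
  rcases eq_or_ne (d x) 0 with hd | hd
  · rw [hd, abs_zero] at habs
    rw [hd, zero_smul, norm_eq_zero.1 habs.symm]
  -- derivative of `d` along the segment to the nearest point
  have hline : HasDerivAt (fun t : ℝ => x + t • (p - x)) (p - x) 0 := by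
    simpa using ((hasDerivAt_id (0 : ℝ)).smul_const (p - x)).const_add x
  have hx0 : x + (0 : ℝ) • (p - x) = x := by simp
  have hcomp : HasDerivAt (fun t : ℝ => d (x + t • (p - x)))
      (inner ℝ (gradient d x) (p - x)) 0 := by
    have := (h.differentiableAt hx).hasFDerivAt
    rw [inner_gradient]
    rw [← hx0] at this
    have := this.comp_hasDerivAt (0 : ℝ) hline
    rw [hx0] at this
    exact this
  -- Near `x` the sign of `d` is constant, so `d` equals `(1 - t) * d x` along the segment. This is
  -- known only for small `t ≥ 0`, since the rest of the segment may leave `U`; hence the one-sided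
  -- derivative.
  have hlin : HasDerivWithinAt (fun t : ℝ => d (x + t • (p - x))) (- d x) (Ici 0) 0 := by
    have h0 : HasDerivWithinAt (fun t : ℝ => (1 - t) * d x) (- d x) (Ici 0) 0 := by
      simpa using (((hasDerivAt_id (0 : ℝ)).const_sub 1).mul_const (d x)).hasDerivWithinAt
    refine h0.congr_of_eventuallyEq ?_ (by simp)
    have hct : ContinuousAt (fun t : ℝ => x + t • (p - x)) 0 := hline.continuousAt
    have hev1 : ∀ᶠ t : ℝ in nhds 0, x + t • (p - x) ∈ U :=
      hct.eventually (by simp only [hx0]; exact h.isOpen.mem_nhds hx)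
    have hev2 : ∀ᶠ t : ℝ in nhds 0, 0 < d x * d (x + t • (p - x)) := by
      have hc := hcomp.continuousAt.const_mul (d x)
      refine hc.eventually (lt_mem_nhds ?_)
      simp only [hx0]
      exact mul_self_pos.2 hd
    have hev3 : ∀ᶠ t : ℝ in nhds 0, t ≤ 1 := ge_mem_nhds one_pos
    filter_upwards [nhdsWithin_le_nhds hev1, nhdsWithin_le_nhds hev2, nhdsWithin_le_nhds hev3,
      self_mem_nhdsWithin] with t h1 h2 h3 h4
    have h5 := h.abs_eq_dist _ h1
    have h6 := infDist_segment hp hpx (t := 1 - t) ⟨by linarith, by linarith [mem_Ici.1 h4]⟩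
    have h7 : p + (1 - t) • (x - p) = x + t • (p - x) := by module
    rw [h7, ← h5, ← habs] at h6
    rcases lt_or_gt_of_ne hd with hneg | hpos
    · rw [abs_of_neg hneg, abs_of_neg (by nlinarith)] at h6
      linarith
    · rw [abs_of_pos hpos, abs_of_pos (by nlinarith)] at h6
      linarith
  have hder : inner ℝ (gradient d x) (p - x) = - d x :=
    (uniqueDiffOn_Ici (0 : ℝ) 0 self_mem_Ici).eq_deriv _ hcomp.hasDerivWithinAt hlin
  have h1 := h.norm_gradient_le_one hx
  -- Expanding the square gives `d² ‖∇d‖² - 2 d² + d²`, which is nonpositive because `‖∇d‖ ≤ 1`.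
  have hsq : ‖d x • gradient d x - (x - p)‖ ^ 2 ≤ 0 := by
    rw [norm_sub_sq_real, norm_smul, inner_smul_left, Real.norm_eq_abs, ← neg_sub p x,
      inner_neg_right, hder, norm_neg, norm_sub_rev, ← habs, mul_pow, sq_abs]
    simp only [conj_trivial]
    nlinarith [mul_nonneg (sq_nonneg (d x)) (sub_nonneg.2 (pow_le_one₀ (n := 2) (norm_nonneg _) h1))]
  exact sub_eq_zero.1 (norm_eq_zero.1 (pow_eq_zero_iff two_ne_zero |>.1
    (le_antisymm hsq (sq_nonneg _))))

lemma exists_nearest (h : IsSmoothSurface Γ U d) (hne : Γ.Nonempty) (x : E3) :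
    ∃ p ∈ Γ, Metric.infDist x Γ = ‖x - p‖ := by
  obtain ⟨p, hp, hd⟩ := h.isCompact.exists_infDist_eq_dist hne x
  exact ⟨p, hp, by rw [hd, dist_eq_norm]⟩

/-- As `p` is an arbitrary nearest point, this also contains the uniqueness of nearest points for
points of `U`. -/
lemma proj_eq (h : IsSmoothSurface Γ U d) {x p : E3} (hx : x ∈ U) (hp : p ∈ Γ)
    (hpx : Metric.infDist x Γ = ‖x - p‖) : proj d x = p := by
  rw [proj, h.smul_gradient_eq hx hp hpx, sub_sub_cancel]

lemma proj_mem (h : IsSmoothSurface Γ U d) (hne : Γ.Nonempty) {x : E3} (hx : x ∈ U) :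
    proj d x ∈ Γ := by
  obtain ⟨p, hp, hpx⟩ := h.exists_nearest hne x
  rwa [h.proj_eq hx hp hpx]

lemma infDist_proj (h : IsSmoothSurface Γ U d) (hne : Γ.Nonempty) {x : E3} (hx : x ∈ U) :
    Metric.infDist x Γ = ‖x - proj d x‖ := by
  obtain ⟨p, hp, hpx⟩ := h.exists_nearest hne x
  rwa [h.proj_eq hx hp hpx]

lemma norm_gradient_eq_one_of_ne (h : IsSmoothSurface Γ U d) (hne : Γ.Nonempty) {x : E3}
    (hx : x ∈ U) (hd : d x ≠ 0) : ‖gradient d x‖ = 1 := by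
  obtain ⟨p, hp, hpx⟩ := h.exists_nearest hne x
  have h1 := congrArg norm (h.smul_gradient_eq hx hp hpx)
  rw [norm_smul, Real.norm_eq_abs, ← hpx, h.abs_eq_dist x hx] at h1
  have h2 : Metric.infDist x Γ ≠ 0 := by rw [← h.abs_eq_dist x hx]; exact abs_ne_zero.2 hd
  exact mul_left_cancel₀ h2 (by rw [h1, mul_one])

/-- The identity for `d ∇d` carries no information where `d = 0`. The value is a limit along `p + t
∇d(p)` as `t ↓ 0`, where `d ≠ 0` because its derivative in `t` is `‖∇d(p)‖² > 0` by regularity. -/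
lemma norm_gradient_eq_one (h : IsSmoothSurface Γ U d) {p : E3} (hp : p ∈ Γ) :
    ‖gradient d p‖ = 1 := by
  have hpU := h.subset hp
  have hg := h.regular p hp
  have hlim : Filter.Tendsto (fun t : ℝ => p + t • gradient d p) (nhdsWithin 0 (Ioi 0))
      (nhds p) := by
    have : ContinuousAt (fun t : ℝ => p + t • gradient d p) 0 := by fun_prop
    have := this.tendsto
    rw [zero_smul, add_zero] at this
    exact this.mono_left nhdsWithin_le_nhds
  have hgc : ContinuousAt (fun x => ‖gradient d x‖) p :=
    (h.continuousOn_gradient.continuousAt (h.isOpen.mem_nhds hpU)).norm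
  refine tendsto_nhds_unique (hgc.tendsto.comp hlim) (tendsto_const_nhds.congr' ?_)
  have hder : HasDerivAt (fun t : ℝ => d (p + t • gradient d p)) (‖gradient d p‖ ^ 2) 0 := by
    have hline : HasDerivAt (fun t : ℝ => p + t • gradient d p) (gradient d p) 0 := by
      simpa using ((hasDerivAt_id (0 : ℝ)).smul_const (gradient d p)).const_add p
    have hx0 : p + (0 : ℝ) • gradient d p = p := by simp
    have := (h.differentiableAt hpU).hasFDerivAt
    rw [← real_inner_self_eq_norm_sq, inner_gradient]
    rw [← hx0] at this
    have := this.comp_hasDerivAt (0 : ℝ) hline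
    rw [hx0] at this
    exact this
  have hpos : 0 < ‖gradient d p‖ ^ 2 := by positivity
  have hne' : ∀ᶠ t : ℝ in nhdsWithin 0 (Ioi 0), d (p + t • gradient d p) ≠ 0 := by
    have := hder.eventually_ne (c := (0 : ℝ)) hpos.ne'
    exact nhdsWithin_mono _ (fun t (ht : 0 < t) => ne_of_gt ht) this
  filter_upwards [hne', hlim.eventually (h.isOpen.mem_nhds hpU)] with t h1 h2
  exact (h.norm_gradient_eq_one_of_ne ⟨p, hp⟩ h2 h1).symm

/-- A point of `U` lies on the normal line through its projection. -/
lemma exists_eq_proj_add_smul (h : IsSmoothSurface Γ U d) (hne : Γ.Nonempty) {x : E3}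
    (hx : x ∈ U) :
    ∃ s : ℝ, |s| = Metric.infDist x Γ ∧ x = proj d x + s • gradient d (proj d x) := by
  set p := proj d x with hpdef
  have hp : p ∈ Γ := h.proj_mem hne hx
  have hpx := h.infDist_proj hne hx
  rw [← hpdef] at hpx
  rcases eq_or_ne x p with hxp | hxp
  · exact ⟨0, by rw [hpx, hxp]; simp, by simp [← hxp]⟩
  have hpos : 0 < ‖x - p‖ := norm_pos_iff.2 (sub_ne_zero.2 hxp)
  set u : E3 := ‖x - p‖⁻¹ • (x - p) with hu
  have hlim : Filter.Tendsto (fun t : ℝ => p + t • (x - p)) (nhdsWithin 0 (Ioi 0)) (nhds p) := by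
    have : ContinuousAt (fun t : ℝ => p + t • (x - p)) 0 := by fun_prop
    have := this.tendsto
    rw [zero_smul, add_zero] at this
    exact this.mono_left nhdsWithin_le_nhds
  have hpU := h.subset hp
  have hgc := (h.continuousOn_gradient.continuousAt (h.isOpen.mem_nhds hpU)).tendsto.comp hlim
  -- Close to `p` the segment towards `x` lies in `U`, and there the gradient is `u` or `-u`; this
  -- finite set is closed, so the limit at `p` stays in it.
  have hmem : gradient d p ∈ ({u, -u} : Set E3) := by
    refine IsClosed.mem_of_tendsto (Set.toFinite _).isClosed hgc ?_
    filter_upwards [hlim.eventually (h.isOpen.mem_nhds hpU), self_mem_nhdsWithin,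
      nhdsWithin_le_nhds (ge_mem_nhds (one_pos (α := ℝ)))] with t hU h0 h1
    have h0' : 0 < t := h0
    have hdist := infDist_segment hp hpx ⟨h0'.le, h1⟩
    have hgr := h.smul_gradient_eq hU hp (by
      rw [hdist, add_sub_cancel_left, norm_smul, Real.norm_of_nonneg h0'.le])
    have habs := h.abs_eq_dist _ hU
    rw [hdist] at habs
    rw [add_sub_cancel_left] at hgr
    have htn : t * ‖x - p‖ ≠ 0 := by positivity
    have htu : t • (x - p) = (t * ‖x - p‖) • u := by
      rw [hu, smul_smul, mul_assoc, mul_inv_cancel₀ hpos.ne', mul_one]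
    replace hgr := hgr.trans htu
    rcases (abs_eq (by positivity)).1 habs with hd | hd
    · left
      rw [hd] at hgr
      exact smul_right_injective E3 htn hgr
    · right
      rw [hd] at hgr
      refine smul_right_injective E3 htn ?_
      simp only [smul_neg, ← hgr, neg_smul, neg_neg, Function.comp_apply]
  have hxu : x - p = ‖x - p‖ • u := by rw [hu, smul_smul, mul_inv_cancel₀ hpos.ne', one_smul]
  rcases hmem with hg | hg
  · refine ⟨‖x - p‖, by rw [hpx, abs_of_pos hpos], ?_⟩
    rw [hg, ← hxu]; abel
  · rw [mem_singleton_iff] at hg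
    refine ⟨-‖x - p‖, by rw [hpx, abs_neg, abs_of_pos hpos], ?_⟩
    rw [hg, smul_neg, neg_smul, neg_neg, ← hxu]; abel

/-- The unit normal is Lipschitz on the surface, and secants are tangential up to second order. -/
lemma exists_lipschitz (h : IsSmoothSurface Γ U d) : ∃ L : ℝ, 0 < L ∧
    (∀ p ∈ Γ, ∀ p' ∈ Γ, ‖gradient d p - gradient d p'‖ ≤ L * ‖p - p'‖) ∧
    ∀ p ∈ Γ, ∀ p' ∈ Γ, |inner ℝ (gradient d p) (p' - p)| ≤ L * ‖p' - p‖ ^ 2 := by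
  obtain ⟨r, hr, hrU⟩ := h.isCompact.exists_cthickening_subset_open h.isOpen h.subset
  have hcomp : IsCompact (Metric.cthickening r Γ) := h.isCompact.cthickening
  have hD : ContDiffOn ℝ ∞ (fderiv ℝ d) U := h.smooth.fderiv_of_isOpen h.isOpen (by simp)
  have hD2 : ContinuousOn (fderiv ℝ (fderiv ℝ d)) U :=
    hD.continuousOn_fderiv_of_isOpen h.isOpen (by simp)
  obtain ⟨B, hB⟩ := hcomp.exists_bound_of_continuousOn (E := E3 →L[ℝ] E3 →L[ℝ] ℝ)
    (hD2.mono hrU)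
  have hball : ∀ p ∈ Γ, Metric.closedBall p r ⊆ Metric.cthickening r Γ := fun p hp =>
    Metric.closedBall_subset_cthickening hp r
  have hlip : ∀ p ∈ Γ, ∀ x ∈ Metric.closedBall p r, ∀ y ∈ Metric.closedBall p r,
      ‖fderiv ℝ d y - fderiv ℝ d x‖ ≤ B * ‖y - x‖ := by
    intro p hp x hx y hy
    refine (convex_closedBall p r).norm_image_sub_le_of_norm_fderiv_le (𝕜 := ℝ)
      (fun z hz => ?_) (fun z hz => hB z (hball p hp hz)) hx hy
    have hz' := hrU (hball p hp hz)
    exact ((hD.differentiableOn (by simp)) z hz').differentiableAt (h.isOpen.mem_nhds hz')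
  -- `B` bounds the second derivative near `Γ` and serves pairs at distance at most `r`; `2 / r`
  -- serves the remaining pairs through the unit length of the normals.
  refine ⟨max B (2 / r), lt_max_of_lt_right (by positivity), ?_, ?_⟩
  · intro p hp p' hp'
    rcases le_or_gt ‖p - p'‖ r with hle | hgt
    · have h1 := hlip p' hp' p' (Metric.mem_closedBall_self hr.le) p
        (by rwa [mem_closedBall_iff_norm])
      have h2 : ‖gradient d p - gradient d p'‖ = ‖fderiv ℝ d p - fderiv ℝ d p'‖ := by
        rw [gradient, gradient, ← map_sub, LinearIsometryEquiv.norm_map]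
      rw [h2]
      exact h1.trans (mul_le_mul_of_nonneg_right (le_max_left _ _) (norm_nonneg _))
    · calc ‖gradient d p - gradient d p'‖ ≤ 1 + 1 := (norm_sub_le _ _).trans
            (add_le_add (h.norm_gradient_eq_one hp).le (h.norm_gradient_eq_one hp').le)
        _ = 2 / r * r := by field_simp; norm_num
        _ ≤ max B (2 / r) * ‖p - p'‖ :=
            mul_le_mul (le_max_right _ _) hgt.le hr.le (le_max_of_le_right (by positivity))
  · intro p hp p' hp'
    rcases le_or_gt ‖p' - p‖ r with hle | hgt
    · have hseg : segment ℝ p p' ⊆ Metric.closedBall p r :=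
        (convex_closedBall p r).segment_subset (Metric.mem_closedBall_self hr.le)
          (by rwa [mem_closedBall_iff_norm])
      have h1 := (convex_segment p p').norm_image_sub_le_of_norm_hasFDerivWithin_le'
        (f := d) (f' := fderiv ℝ d) (φ := fderiv ℝ d p) (C := B * ‖p' - p‖)
        (fun z hz => (h.differentiableAt (hrU (hball p hp (hseg hz)))).hasFDerivAt.hasFDerivWithinAt)
        (fun z hz => by
          refine (hlip p hp p (Metric.mem_closedBall_self hr.le) z (hseg hz)).trans ?_
          have hB0 : 0 ≤ B := (norm_nonneg _).trans
            (hB p (hball p hp (Metric.mem_closedBall_self hr.le)))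
          refine mul_le_mul_of_nonneg_left ?_ hB0
          exact norm_sub_le_of_mem_segment hz)
        (left_mem_segment ℝ p p') (right_mem_segment ℝ p p')
      rw [h.dist_zero hp, h.dist_zero hp', sub_zero, zero_sub, norm_neg, Real.norm_eq_abs] at h1
      rw [inner_gradient]
      refine h1.trans ?_
      rw [mul_assoc, ← sq]
      exact mul_le_mul_of_nonneg_right (le_max_left _ _) (sq_nonneg _)
    · have h1 := abs_real_inner_le_norm (gradient d p) (p' - p)
      rw [h.norm_gradient_eq_one hp, one_mul] at h1
      calc _ ≤ ‖p' - p‖ := h1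
        _ ≤ 2 / r * r * ‖p' - p‖ := by
            rw [div_mul_cancel₀ _ hr.ne']; linarith [norm_nonneg (p' - p)]
        _ ≤ max B (2 / r) * ‖p' - p‖ * ‖p' - p‖ := by
            gcongr; exact le_max_right _ _
        _ = _ := by ring

end IsSmoothSurface

/-! ### Shape-regular triangles -/

lemma mem_convexHull_triple {a b c x : E3} : x ∈ convexHull ℝ ({a, b, c} : Set E3) ↔
    ∃ u v : ℝ, 0 ≤ u ∧ 0 ≤ v ∧ u + v ≤ 1 ∧ x = a + u • (b - a) + v • (c - a) := by
  constructor
  · intro hx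
    rw [convexHull_insert (by simp), convexHull_pair, mem_convexJoin] at hx
    obtain ⟨a', rfl, y, ⟨s, t, hs, ht, hst, rfl⟩, ⟨p, q, hp, hq, hpq, rfl⟩⟩ := hx
    refine ⟨q * s, q * t, by positivity, by positivity, ?_, ?_⟩
    · rw [← mul_add, hst]; linarith
    · obtain rfl : p = 1 - q := by linarith
      obtain rfl : s = 1 - t := by linarith
      module
  · rintro ⟨u, v, hu, hv, huv, rfl⟩
    have hc := convex_convexHull ℝ ({a, b, c} : Set E3)
    have := hc.sum_mem (t := (Finset.univ : Finset (Fin 3))) (w := ![1 - u - v, u, v])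
      (z := ![a, b, c]) (by
        intro i _; fin_cases i <;> simp <;> linarith) (by simp [Fin.sum_univ_three]; ring) (by
        intro i _; apply subset_convexHull; fin_cases i <;> simp)
    simp only [Fin.sum_univ_three, Matrix.cons_val_zero, Matrix.cons_val_one,
      Matrix.cons_val] at this
    convert this using 1
    module

/-- The triangle with vertices `a`, `b`, `c` contains a disc of radius `r`. -/
def HasInscribedDisc (a b c : E3) (r : ℝ) : Prop :=
  ∃ x ∈ convexHull ℝ ({a, b, c} : Set E3), Metric.closedBall x r ∩
    (affineSpan ℝ ({a, b, c} : Set E3) : Set E3) ⊆ convexHull ℝ ({a, b, c} : Set E3)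

/-- Moving the centre of the disc by length `r` in direction `t` stays in the triangle, so each
barycentric coordinate changes by at most one; rescaling gives the three bounds. -/
lemma HasInscribedDisc.exists_coeff {a b c : E3} {r : ℝ} (h : HasInscribedDisc a b c r)
    (hr : 0 < r) {t : E3} (ht : t ∈ vectorSpan ℝ ({a, b, c} : Set E3)) :
    ∃ α β : ℝ, t = α • (b - a) + β • (c - a) ∧ |α| ≤ ‖t‖ / r ∧ |β| ≤ ‖t‖ / r ∧
      |α + β| ≤ ‖t‖ / r := by
  rcases eq_or_ne t 0 with rfl | ht0
  · exact ⟨0, 0, by simp, by simp, by simp, by simp⟩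
  obtain ⟨x, hx, hsub⟩ := h
  have htn : 0 < ‖t‖ := norm_pos_iff.2 ht0
  have hy : x + (r / ‖t‖) • t ∈ convexHull ℝ ({a, b, c} : Set E3) := by
    apply hsub
    refine ⟨?_, ?_⟩
    · rw [mem_closedBall_iff_norm, add_sub_cancel_left, norm_smul, Real.norm_of_nonneg (by positivity),
        div_mul_cancel₀ _ htn.ne']
    · have h1 : x ∈ affineSpan ℝ ({a, b, c} : Set E3) := convexHull_subset_affineSpan _ hx
      rw [add_comm]
      exact AffineSubspace.vadd_mem_of_mem_direction
        (by rw [direction_affineSpan]; exact Submodule.smul_mem _ _ ht) h1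
  obtain ⟨u, v, hu, hv, huv, hxe⟩ := mem_convexHull_triple.1 hx
  obtain ⟨u', v', hu', hv', huv', hye⟩ := mem_convexHull_triple.1 hy
  have hpos : 0 ≤ ‖t‖ / r := by positivity
  refine ⟨‖t‖ / r * (u' - u), ‖t‖ / r * (v' - v), ?_, ?_, ?_, ?_⟩
  · have h1 : (r / ‖t‖) • t = (u' - u) • (b - a) + (v' - v) • (c - a) := by
      have h2 : (r / ‖t‖) • t = (x + (r / ‖t‖) • t) - x := by abel
      rw [h2, hye, hxe]; module
    rw [mul_smul, mul_smul, ← smul_add, ← h1, smul_smul]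
    rw [div_mul_div_comm, mul_comm r, div_self (by positivity), one_smul]
  · rw [abs_mul, abs_of_nonneg hpos]
    exact mul_le_of_le_one_right hpos (abs_le.2 ⟨by linarith, by linarith⟩)
  · rw [abs_mul, abs_of_nonneg hpos]
    exact mul_le_of_le_one_right hpos (abs_le.2 ⟨by linarith, by linarith⟩)
  · rw [← mul_add, abs_mul, abs_of_nonneg hpos]
    exact mul_le_of_le_one_right hpos (abs_le.2 ⟨by linarith, by linarith⟩)

lemma vectorSpan_convexHull (s : Set E3) : vectorSpan ℝ (convexHull ℝ s) = vectorSpan ℝ s := by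
  rw [← direction_affineSpan, affineSpan_convexHull, direction_affineSpan]

lemma sub_mem_vectorSpan_triple (a b c : E3) :
    b - a ∈ vectorSpan ℝ ({a, b, c} : Set E3) ∧ c - a ∈ vectorSpan ℝ ({a, b, c} : Set E3) :=
  ⟨vsub_mem_vectorSpan ℝ (by simp) (by simp), vsub_mem_vectorSpan ℝ (by simp) (by simp)⟩

section Conormal

variable {a b c n : E3} {r : ℝ}

lemma IsConormal.inner_edge {K : Set E3} (hn : IsConormal n K (segment ℝ a b))
    (ha : a ∈ K) (hb : b ∈ K) : inner ℝ n (b - a) = 0 := by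
  have h1 := hn.outward a (left_mem_segment ℝ a b) b hb
  have h2 := hn.outward b (right_mem_segment ℝ a b) a ha
  rw [← neg_sub b a, inner_neg_right] at h2
  linarith

/-- The height of a triangle over an edge is at least the inradius. -/
lemma IsConormal.le_height (hn : IsConormal n (convexHull ℝ {a, b, c}) (segment ℝ a b))
    (h : HasInscribedDisc a b c r) (hr : 0 < r) : r ≤ - inner ℝ n (c - a) := by
  have hsub := subset_convexHull ℝ ({a, b, c} : Set E3)
  have h0 := hn.inner_edge (hsub (by simp)) (hsub (by simp))
  have h1 := hn.outward a (left_mem_segment ℝ a b) c (hsub (by simp))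
  have ht := hn.tangential
  rw [vectorSpan_convexHull] at ht
  -- The conormal itself is expanded: `1 = β * ⟪n, c - a⟫` with `|β| ≤ 1 / r`.
  obtain ⟨α, β, he, -, hβ, -⟩ := h.exists_coeff hr ht
  have h2 : inner ℝ n n = β * inner ℝ n (c - a) := by
    nth_rw 2 [he]
    rw [inner_add_right, inner_smul_right, inner_smul_right, h0]; ring
  rw [real_inner_self_eq_norm_sq, hn.unit] at h2
  rw [hn.unit] at hβ
  have h3 := neg_abs_le β
  have h4 : 1 ≤ 1 / r * (- inner ℝ n (c - a)) := by nlinarith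
  calc r = r * 1 := by ring
    _ ≤ r * (1 / r * (- inner ℝ n (c - a))) := by gcongr
    _ = _ := by field_simp

/-- Half discs around the midpoint of an edge belong to the triangle. -/
lemma IsConormal.mem_convexHull (hn : IsConormal n (convexHull ℝ {a, b, c}) (segment ℝ a b))
    (h : HasInscribedDisc a b c r) (hr : 0 < r) {t : E3}
    (ht : t ∈ vectorSpan ℝ ({a, b, c} : Set E3)) (htr : ‖t‖ ≤ r / 4) (hin : inner ℝ n t ≤ 0) :
    a + (1 / 2 : ℝ) • (b - a) + t ∈ convexHull ℝ ({a, b, c} : Set E3) := by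
  have hsub := subset_convexHull ℝ ({a, b, c} : Set E3)
  have h0 := hn.inner_edge (hsub (by simp)) (hsub (by simp))
  have hh := hn.le_height h hr
  obtain ⟨α, β, he, hα, hβ, -⟩ := h.exists_coeff hr ht
  -- Coefficients of size at most `1 / 4` keep `1 / 2 + α` nonnegative and `1 / 2 + α + β` at most
  -- one; only `β ≥ 0` needs the half-plane condition.
  have h4 : ‖t‖ / r ≤ 1 / 4 := by
    rw [div_le_iff₀ hr]; linarith
  rw [he, inner_add_right, inner_smul_right, inner_smul_right, h0, mul_zero, zero_add] at hin
  have hβ0 : 0 ≤ β := by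
    by_contra hlt
    push Not at hlt
    nlinarith [mul_pos_of_neg_of_neg hlt (show inner ℝ n (c - a) < 0 by linarith)]
  have ha' := abs_le.1 (hα.trans h4)
  have hb' := abs_le.1 (hβ.trans h4)
  refine mem_convexHull_triple.2 ⟨1 / 2 + α, β, by linarith, hβ0, by linarith, ?_⟩
  rw [he]; module

lemma exists_isConormal (h : ¬ Collinear ℝ ({a, b, c} : Set E3)) :
    ∃ n, IsConormal n (convexHull ℝ {a, b, c}) (segment ℝ a b) := by
  set e := b - a with he
  set f := c - a with hf
  have hab : e ≠ 0 := by
    intro h0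
    rw [he, sub_eq_zero] at h0
    apply h
    rw [h0]
    simpa using collinear_pair ℝ a c
  have hee : inner ℝ e e ≠ 0 := inner_self_ne_zero.2 hab
  -- Minus the component of `f` orthogonal to the edge, so that it points away from the third
  -- vertex.
  set g : E3 := (inner ℝ f e / inner ℝ e e) • e - f with hg
  have hg0 : g ≠ 0 := by
    intro h0
    apply h
    rw [collinear_iff_of_mem (p₀ := a) (by simp)]
    refine ⟨e, ?_⟩
    rintro p (rfl | rfl | rfl)
    · exact ⟨0, by simp⟩
    · exact ⟨1, by simp [he]⟩
    · refine ⟨inner ℝ f e / inner ℝ e e, ?_⟩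
      rw [sub_eq_zero] at h0
      rw [h0, hf]; simp
  have hge : inner ℝ g e = 0 := by
    rw [hg, inner_sub_left, inner_smul_left, conj_trivial, div_mul_cancel₀ _ hee, sub_self]
  have hgf : inner ℝ g f = - inner ℝ g g := by
    have : f = (inner ℝ f e / inner ℝ e e) • e - g := by rw [hg]; abel
    nth_rw 1 [this]
    rw [inner_sub_right, inner_smul_right, hge]; ring
  have hgn : 0 < ‖g‖ := norm_pos_iff.2 hg0
  have hspan := sub_mem_vectorSpan_triple a b c
  refine ⟨‖g‖⁻¹ • g, ?_, ?_, ?_⟩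
  · rw [norm_smul, norm_inv, norm_norm, inv_mul_cancel₀ hgn.ne']
  · rw [vectorSpan_convexHull]
    exact Submodule.smul_mem _ _ (Submodule.sub_mem _ (Submodule.smul_mem _ _ hspan.1) hspan.2)
  · rintro x ⟨p, q, hp, hq, hpq, rfl⟩ y hy
    obtain ⟨u, v, hu, hv, huv, rfl⟩ := mem_convexHull_triple.1 hy
    obtain rfl : p = 1 - q := by linarith
    have : a + u • (b - a) + v • (c - a) - ((1 - q) • a + q • b) = (u - q) • e + v • f := by
      rw [he, hf]; module
    rw [this, inner_smul_left, inner_add_right, inner_smul_right, inner_smul_right, hge, hgf,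
      conj_trivial, mul_zero, zero_add]
    have h1 : 0 ≤ ‖g‖⁻¹ := by positivity
    have h2 : 0 ≤ inner ℝ g g := real_inner_self_nonneg
    have := mul_nonneg h1 (mul_nonneg hv h2)
    linarith

end Conormal

/-! ### Almost tangential planes, average conormals and absence of folds -/

/-- In the applications `x` is a conormal and `y` the unit tangent of the edge, so `N` is a unit
normal of the plane of a triangle. -/
lemma exists_orthonormal_completion {x y : E3} (hx : ‖x‖ = 1) (hy : ‖y‖ = 1)
    (hxy : inner ℝ x y = 0) : ∃ N : E3,
      (∀ u w : E3, inner ℝ u w = inner ℝ u x * inner ℝ w x + inner ℝ u y * inner ℝ w y +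
        inner ℝ u N * inner ℝ w N) ∧
      ∀ u : E3, u = inner ℝ u x • x + inner ℝ u y • y + inner ℝ u N • N := by
  have hne : x ≠ y := by
    rintro rfl
    rw [real_inner_self_eq_norm_sq, hx] at hxy
    norm_num at hxy
  have ho : Orthonormal ℝ (({0, 1} : Set (Fin 3)).domRestrict (![x, y, 0] : Fin 3 → E3)) := by
    refine ⟨?_, ?_⟩
    · rintro ⟨i, hi⟩
      rcases hi with rfl | rfl
      · exact hx
      · exact hy
    · rintro ⟨i, hi⟩ ⟨j, hj⟩ hij
      rcases hi with rfl | rfl <;> rcases hj with rfl | rfl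
      · exact absurd rfl hij
      · exact hxy
      · exact (real_inner_comm x y).trans hxy
      · exact absurd rfl hij
  obtain ⟨B, hB⟩ := ho.exists_orthonormalBasis_extension_of_card_eq (by simp)
  have h0 : B 0 = x := by simpa using hB 0 (by simp)
  have h1 : B 1 = y := by simpa using hB 1 (by simp)
  refine ⟨B 2, fun u w => ?_, fun u => ?_⟩
  · rw [← B.sum_inner_mul_inner u w, Fin.sum_univ_three, h0, h1, real_inner_comm x w,
      real_inner_comm y w, real_inner_comm (B 2) w]
  · nth_rw 1 [← B.sum_repr' u]
    rw [Fin.sum_univ_three, h0, h1, real_inner_comm x u, real_inner_comm y u,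
      real_inner_comm (B 2) u]

/-- `L` is a Lipschitz constant of the unit normal field `ν`, and bounds the deviation of secants
from the tangent planes. -/
structure NormalBound (Γ : Set E3) (ν : E3 → E3) (L : ℝ) : Prop where
  pos : 0 < L
  unit : ∀ p ∈ Γ, ‖ν p‖ = 1
  lipschitz : ∀ p ∈ Γ, ∀ p' ∈ Γ, ‖ν p - ν p'‖ ≤ L * ‖p - p'‖
  secant : ∀ p ∈ Γ, ∀ p' ∈ Γ, |inner ℝ (ν p) (p' - p)| ≤ L * ‖p' - p‖ ^ 2

lemma IsSmoothSurface.exists_normalBound {Γ U : Set E3} {d : E3 → ℝ}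
    (h : IsSmoothSurface Γ U d) : ∃ L, NormalBound Γ (gradient d) L := by
  obtain ⟨L, hL, h1, h2⟩ := h.exists_lipschitz
  exact ⟨L, hL, fun p hp => h.norm_gradient_eq_one hp, h1, h2⟩

namespace NormalBound

variable {Γ : Set E3} {ν : E3 → E3} {L : ℝ}

/-- Short normal segments do not intersect. -/
lemma eq_of_add_smul_eq (hν : NormalBound Γ ν L) {p p' : E3} (hp : p ∈ Γ) (hp' : p' ∈ Γ)
    {s s' H : ℝ} (hs : |s| ≤ 2 * H) (hs' : |s'| ≤ 2 * H) (hH : 8 * L * H < 1)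
    (h : p + s • ν p = p' + s' • ν p') : p = p' := by
  have hL := hν.pos
  set D := ‖p - p'‖ with hD
  have hdiff : p - p' = (s' - s) • ν p + s' • (ν p' - ν p) := by
    have : p - p' = (p + s • ν p) - p' - s • ν p := by abel
    rw [this, h]; module
  have hlip : ‖ν p' - ν p‖ ≤ L * D := by
    have := hν.lipschitz p' hp' p hp
    rwa [norm_sub_rev p' p] at this
  have hD0 : 0 ≤ D := norm_nonneg _
  have hH0 : 0 ≤ H := by linarith [abs_nonneg s]
  have h1 : ‖s' • (ν p' - ν p)‖ ≤ 2 * H * (L * D) := by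
    rw [norm_smul, Real.norm_eq_abs]
    exact mul_le_mul hs' hlip (norm_nonneg _) (by positivity)
  have hDle : D ≤ |s' - s| + 2 * H * (L * D) := by
    rw [hD, hdiff]
    refine (norm_add_le _ _).trans ?_
    rw [← hdiff, norm_smul, hν.unit p hp, mul_one, Real.norm_eq_abs]
    exact add_le_add le_rfl h1
  -- This crude bound makes the quadratic term `L * D ^ 2` of the secant estimate linear in `D`;
  -- altogether `D ≤ 8 * L * H * D` with a factor below one.
  have hD4 : D ≤ 4 * H := by
    have : p - p' = s' • ν p' - s • ν p := by
      have : p - p' = (p + s • ν p) - p' - s • ν p := by abel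
      rw [this, h]; module
    rw [hD, this]
    refine (norm_sub_le _ _).trans ?_
    rw [norm_smul, norm_smul, hν.unit p hp, hν.unit p' hp', Real.norm_eq_abs, Real.norm_eq_abs]
    linarith
  have hsd : |s' - s| ≤ L * D ^ 2 + 2 * H * (L * D) := by
    have h2 : inner ℝ (ν p) (p - p') = (s' - s) + inner ℝ (ν p) (s' • (ν p' - ν p)) := by
      nth_rw 1 [hdiff]
      rw [inner_add_right, inner_smul_right, real_inner_self_eq_norm_sq, hν.unit p hp]; ring
    have h3 := hν.secant p hp p' hp'
    rw [norm_sub_rev, ← neg_sub p p', inner_neg_right, abs_neg] at h3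
    have h4 := abs_real_inner_le_norm (ν p) (s' • (ν p' - ν p))
    rw [hν.unit p hp, one_mul] at h4
    have h5 : s' - s = inner ℝ (ν p) (p - p') - inner ℝ (ν p) (s' • (ν p' - ν p)) := by
      rw [h2]; ring
    rw [h5]
    exact (abs_sub _ _).trans (add_le_add h3 (h4.trans h1))
  have hDD : L * D ^ 2 ≤ L * (4 * H) * D := by
    rw [sq, ← mul_assoc]; gcongr
  have hfin : D ≤ 8 * L * H * D := by linarith
  have hzero : D = 0 := by
    by_contra hne
    have : 0 < D := lt_of_le_of_ne hD0 (Ne.symm hne)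
    nlinarith
  exact sub_eq_zero.1 (norm_eq_zero.1 hzero)

/-- The plane of a shape-regular triangle with vertices on the surface is almost tangential. -/
lemma abs_inner_le (hν : NormalBound Γ ν L) {a b c p t : E3} (ha : a ∈ Γ) (hb : b ∈ Γ)
    (hc : c ∈ Γ) (hp : p ∈ Γ) {r σ δ H : ℝ} (hr : 0 < r) (hdisc : HasInscribedDisc a b c r)
    (hba : ‖b - a‖ ≤ δ) (hca : ‖c - a‖ ≤ δ) (hδ : δ ≤ σ * r) (hδH : δ ≤ H)
    (hpa : ‖p - a‖ ≤ 2 * H) (ht : t ∈ vectorSpan ℝ ({a, b, c} : Set E3)) :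
    |inner ℝ t (ν p)| ≤ 6 * σ * L * H * ‖t‖ := by
  have hL := hν.pos
  have hδ0 : 0 ≤ δ := (norm_nonneg _).trans hba
  -- One `L * H * δ` is the secant bound at `a`, the other two come from replacing `ν a` by `ν p` at
  -- distance at most `2 * H`.
  have hedge : ∀ x ∈ Γ, ‖x - a‖ ≤ δ → |inner ℝ (x - a) (ν p)| ≤ 3 * L * H * δ := by
    intro x hx hxδ
    have h1 := hν.secant a ha x hx
    have h2 := abs_real_inner_le_norm (x - a) (ν p - ν a)
    have h3 : inner ℝ (x - a) (ν p) = inner ℝ (ν a) (x - a) + inner ℝ (x - a) (ν p - ν a) := by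
      rw [real_inner_comm (x - a) (ν a), ← inner_add_right, add_sub_cancel]
    rw [h3]
    refine (abs_add_le _ _).trans ?_
    have h4 : L * ‖x - a‖ ^ 2 ≤ L * (H * δ) := by
      rw [sq]
      exact mul_le_mul_of_nonneg_left (mul_le_mul (hxδ.trans hδH) hxδ (norm_nonneg _)
        (hδ0.trans hδH)) hL.le
    have h5 : ‖x - a‖ * ‖ν p - ν a‖ ≤ δ * (L * (2 * H)) := by
      gcongr
      exact (hν.lipschitz p hp a ha).trans (by gcongr)
    linarith
  obtain ⟨α, β, he, hα, hβ, -⟩ := hdisc.exists_coeff hr ht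
  rw [he, inner_add_left, inner_smul_left, inner_smul_left, ← he]
  simp only [conj_trivial]
  have hH : 0 ≤ H := hδ0.trans hδH
  calc _ ≤ |α| * |inner ℝ (b - a) (ν p)| + |β| * |inner ℝ (c - a) (ν p)| := by
        rw [← abs_mul, ← abs_mul]; exact abs_add_le _ _
    _ ≤ ‖t‖ / r * (3 * L * H * (σ * r)) + ‖t‖ / r * (3 * L * H * (σ * r)) := by
        have h1 : 3 * L * H * δ ≤ 3 * L * H * (σ * r) := by gcongr
        have h2 := (hedge b hb hba).trans h1
        have h3 := (hedge c hc hca).trans h1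
        gcongr
    _ = _ := by field_simp; ring

end NormalBound

/-- Two conormals of almost tangential planes along a common edge are almost parallel. -/
lemma conormal_dichotomy_bounds {x y τ N ν : E3} {κ : ℝ} (hκ : κ ≤ 1 / 8)
    (hx : ‖x‖ = 1) (hy : ‖y‖ = 1) (hyτ : inner ℝ y τ = 0) (hν : ‖ν‖ = 1)
    (hxν : |inner ℝ x ν| ≤ κ) (hyν : |inner ℝ y ν| ≤ κ) (hτν : |inner ℝ τ ν| ≤ κ)
    (hN : ∀ u w : E3, inner ℝ u w = inner ℝ u x * inner ℝ w x + inner ℝ u τ * inner ℝ w τ +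
        inner ℝ u N * inner ℝ w N) :
    1 / 2 ≤ |inner ℝ ν N| ∧ |inner ℝ y N| ≤ 4 * κ ∧
      inner ℝ y x ^ 2 + inner ℝ y N ^ 2 = 1 := by
  have hκ0 : 0 ≤ κ := (abs_nonneg _).trans hxν
  have h1 := hN ν ν
  rw [real_inner_self_eq_norm_sq, hν, real_inner_comm x ν, real_inner_comm τ ν] at h1
  have h2 := hN y y
  rw [real_inner_self_eq_norm_sq, hy, hyτ] at h2
  have h3 := hN y ν
  rw [hyτ, real_inner_comm x ν] at h3
  have hsx : inner ℝ x ν ^ 2 ≤ κ ^ 2 := sq_le_sq' (abs_le.1 hxν).1 (abs_le.1 hxν).2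
  have hsτ : inner ℝ τ ν ^ 2 ≤ κ ^ 2 := sq_le_sq' (abs_le.1 hτν).1 (abs_le.1 hτν).2
  have hκ2 : κ ^ 2 ≤ 1 / 64 := by nlinarith
  -- The unit vector `ν` has components at most `κ` along `x` and `τ`, so most of it lies along `N`.
  -- Solving the expansion of `⟪y, ν⟫` for `⟪y, N⟫` then costs only a factor two.
  have hhalf : 1 / 2 ≤ |inner ℝ ν N| := by
    refine le_of_sq_le_sq ?_ (abs_nonneg _)
    rw [sq_abs]; nlinarith
  refine ⟨hhalf, ?_, by nlinarith⟩
  have hyx : |inner ℝ y x| ≤ 1 := by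
    have := abs_real_inner_le_norm y x
    rwa [hx, hy, mul_one] at this
  have h4 : |inner ℝ y N * inner ℝ ν N| ≤ 2 * κ := by
    have : inner ℝ y N * inner ℝ ν N = inner ℝ y ν - inner ℝ y x * inner ℝ x ν := by
      linarith
    rw [this]
    refine (abs_sub _ _).trans ?_
    rw [abs_mul]
    have : |inner ℝ y x| * |inner ℝ x ν| ≤ 1 * κ := by gcongr
    linarith
  rw [abs_mul] at h4
  nlinarith [abs_nonneg (inner ℝ y N)]

/-- If the conormals point to opposite sides, the average conormal agrees with the conormal up to
second order when tested with tangential vectors. -/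
lemma abs_inner_avgConormal_sub_le {x y τ ν w : E3} {κ M : ℝ} (hκ : κ ≤ 1 / 8)
    (hx : ‖x‖ = 1) (hy : ‖y‖ = 1) (hτ : ‖τ‖ = 1) (hxτ : inner ℝ x τ = 0) (hyτ : inner ℝ y τ = 0)
    (hν : ‖ν‖ = 1) (hxν : |inner ℝ x ν| ≤ κ) (hyν : |inner ℝ y ν| ≤ κ) (hτν : |inner ℝ τ ν| ≤ κ)
    (hopp : inner ℝ y x ≤ 0) (hw : inner ℝ w ν = 0) (hwM : ‖w‖ ≤ M) :
    |inner ℝ w (avgConormal x y - x)| ≤ 24 * κ ^ 2 * M := by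
  obtain ⟨N, hN, -⟩ := exists_orthonormal_completion hx hτ hxτ
  obtain ⟨h1, h2, h3⟩ := conormal_dichotomy_bounds hκ hx hy hyτ hν hxν hyν hτν hN
  have hκ0 : 0 ≤ κ := (abs_nonneg _).trans hxν
  have hM : 0 ≤ M := (norm_nonneg _).trans hwM
  set c := inner ℝ y x with hc
  have hyN2 : inner ℝ y N ^ 2 ≤ 16 * κ ^ 2 := by
    have := sq_le_sq' (abs_le.1 h2).1 (abs_le.1 h2).2
    linarith
  have hc1 : -1 ≤ c := by nlinarith [sq_nonneg (inner ℝ y N)]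
  -- Since `c ≤ 0`, `1 + c ≤ (1 + c) * (1 - c) = ⟪y, N⟫ ^ 2`.
  have hc2 : 1 + c ≤ 16 * κ ^ 2 := by nlinarith
  have hbound : ∀ z : E3, ‖z‖ = 1 → |inner ℝ w z| ≤ M := fun z hz => by
    have := abs_real_inner_le_norm w z
    rw [hz, mul_one] at this
    exact this.trans hwM
  have hwN : |inner ℝ w N| ≤ 4 * κ * M := by
    have h4 := hN w ν
    rw [hw, real_inner_comm x ν, real_inner_comm τ ν] at h4
    have h5 : |inner ℝ w N * inner ℝ ν N| ≤ 2 * κ * M := by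
      have : inner ℝ w N * inner ℝ ν N =
          -(inner ℝ w x * inner ℝ x ν + inner ℝ w τ * inner ℝ τ ν) := by linarith
      rw [this, abs_neg]
      refine (abs_add_le _ _).trans ?_
      rw [abs_mul, abs_mul]
      have := mul_le_mul (hbound x hx) hxν (abs_nonneg _) hM
      have := mul_le_mul (hbound τ hτ) hτν (abs_nonneg _) hM
      linarith
    rw [abs_mul] at h5
    nlinarith [abs_nonneg (inner ℝ w N)]
  -- Here `x + y = (1 + c) x + ⟪y, N⟫ N`. The first coefficient is already quadratic; the second is
  -- linear but meets `⟪w, N⟫`, also linear in `κ` by tangentiality of `w`.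
  have hu : |inner ℝ w (x + y)| ≤ 32 * κ ^ 2 * M := by
    have h4 := hN w (x + y)
    have hxN : inner ℝ x N = 0 := by
      have := hN x x
      rw [hxτ, real_inner_self_eq_norm_sq, hx] at this
      nlinarith [sq_nonneg (inner ℝ x N)]
    rw [inner_add_left, inner_add_left, inner_add_left, hxτ, hyτ, hxN,
      real_inner_self_eq_norm_sq, hx, ← hc] at h4
    have h5 : inner ℝ w (x + y) = inner ℝ w x * (1 + c) + inner ℝ w N * inner ℝ y N := by
      rw [h4]; ring
    rw [h5]
    refine (abs_add_le _ _).trans ?_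
    rw [abs_mul, abs_mul, abs_of_nonneg (by linarith : 0 ≤ 1 + c)]
    have e1 := mul_le_mul (hbound x hx) hc2 (by linarith) hM
    have e2 := mul_le_mul hwN h2 (abs_nonneg _) (by positivity)
    nlinarith
  set g : E3 := (1 / 2 : ℝ) • (x - y) with hg
  have hgsq : ‖g‖ ^ 2 = (1 - c) / 2 := by
    rw [hg, norm_smul, mul_pow, norm_sub_sq_real, hx, hy, real_inner_comm y x, ← hc,
      Real.norm_of_nonneg (by norm_num)]
    ring
  have hgpos : 0 < ‖g‖ := by
    by_contra hle
    have : ‖g‖ = 0 := le_antisymm (not_lt.1 hle) (norm_nonneg _)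
    rw [this] at hgsq
    linarith
  have hg1 : ‖g‖ ≤ 1 := by
    refine (sq_le_one_iff₀ hgpos.le).1 ?_
    linarith
  have hgle : ‖g‖ ^ 2 ≤ ‖g‖ := pow_le_of_le_one hgpos.le hg1 two_ne_zero
  have hg2 : 1 - ‖g‖ ≤ 8 * κ ^ 2 := by linarith
  -- Normalization error plus averaging error; they contribute `8 * κ ^ 2` and `16 * κ ^ 2`.
  have hdec : avgConormal x y - x = (1 - ‖g‖) • (‖g‖⁻¹ • g) - (1 / 2 : ℝ) • (x + y) := by
    have : (1 - ‖g‖) • (‖g‖⁻¹ • g) = ‖g‖⁻¹ • g - g := by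
      rw [sub_smul, one_smul, smul_inv_smul₀ hgpos.ne']
    rw [this, avgConormal, ← hg]
    nth_rw 4 [hg]
    module
  have hgu : ‖‖g‖⁻¹ • g‖ = 1 := by rw [norm_smul, norm_inv, norm_norm, inv_mul_cancel₀ hgpos.ne']
  have hgw := hbound _ hgu
  rw [hdec]
  clear_value g
  rw [inner_sub_right, inner_smul_right, inner_smul_right (r := (1 / 2 : ℝ))]
  refine (abs_sub _ _).trans ?_
  rw [abs_mul, abs_mul (1 / 2 : ℝ), abs_of_nonneg (by linarith : 0 ≤ 1 - ‖g‖),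
    abs_of_nonneg (by norm_num : (0 : ℝ) ≤ 1 / 2)]
  have hκκ : 0 ≤ 8 * κ ^ 2 := by positivity
  have e3 := mul_le_mul hg2 hgw (abs_nonneg _) hκκ
  linarith

/-- An inequality because the quotient is `0` when `x = y`; it is used on coarse meshes, where a
fold is not excluded. -/
lemma norm_avgConormal_le_one (x y : E3) : ‖avgConormal x y‖ ≤ 1 := by
  rw [avgConormal, norm_smul, norm_inv, norm_norm]
  exact inv_mul_le_one

/-- A shape-regular triangle of diameter at most `H` with vertices on `Γ`. -/
structure AdmissibleTriangle (Γ : Set E3) (σ H : ℝ) (a b c : E3) (r δ : ℝ) : Prop where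
  mem_a : a ∈ Γ
  mem_b : b ∈ Γ
  mem_c : c ∈ Γ
  pos : 0 < r
  disc : HasInscribedDisc a b c r
  norm_sub_le : ∀ x ∈ convexHull ℝ ({a, b, c} : Set E3), ‖x - a‖ ≤ δ
  le_mul : δ ≤ σ * r
  le : δ ≤ H

lemma AdmissibleTriangle.abs_inner_le {Γ : Set E3} {ν : E3 → E3} {σ H L r δ : ℝ} {a b c p t : E3}
    (hT : AdmissibleTriangle Γ σ H a b c r δ) (hν : NormalBound Γ ν L) (hp : p ∈ Γ)
    (hpa : ‖p - a‖ ≤ 2 * H) (ht : t ∈ vectorSpan ℝ ({a, b, c} : Set E3)) :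
    |inner ℝ t (ν p)| ≤ 6 * σ * L * H * ‖t‖ :=
  hν.abs_inner_le hT.mem_a hT.mem_b hT.mem_c hp hT.pos hT.disc
    (hT.norm_sub_le _ (subset_convexHull ℝ _ (by simp)))
    (hT.norm_sub_le _ (subset_convexHull ℝ _ (by simp))) hT.le_mul hT.le hpa ht

lemma AdmissibleTriangle.abs_inner_le_of_unit {Γ : Set E3} {ν : E3 → E3} {σ H L r δ : ℝ}
    {a b c p t : E3} (hT : AdmissibleTriangle Γ σ H a b c r δ) (hν : NormalBound Γ ν L)
    (hp : p ∈ Γ) (hpa : ‖p - a‖ ≤ 2 * H) (ht : t ∈ vectorSpan ℝ ({a, b, c} : Set E3))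
    (ht1 : ‖t‖ = 1) : |inner ℝ t (ν p)| ≤ 6 * σ * L * H := by
  have := hT.abs_inner_le hν hp hpa ht
  rwa [ht1, mul_one] at this

lemma IsSmoothSurface.norm_proj_sub_le {Γ U : Set E3} {d : E3 → ℝ} (hΓ : IsSmoothSurface Γ U d)
    {x a : E3} {H : ℝ} (hx : x ∈ U) (ha : a ∈ Γ) (hxa : ‖x - a‖ ≤ H) :
    Metric.infDist x Γ ≤ H ∧ ‖proj d x - a‖ ≤ 2 * H := by
  have h1 : Metric.infDist x Γ ≤ H := by
    refine (Metric.infDist_le_dist_of_mem ha).trans ?_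
    rwa [dist_eq_norm]
  refine ⟨h1, ?_⟩
  rw [hΓ.infDist_proj ⟨a, ha⟩ hx] at h1
  have h2 := norm_sub_le_norm_sub_add_norm_sub (proj d x) x a
  rw [norm_sub_rev (proj d x) x] at h2
  linarith

/-- The unit tangent of an edge. -/
lemma unit_edge {a b c : E3} (hab : a ≠ b) :
    ‖‖b - a‖⁻¹ • (b - a)‖ = 1 ∧ ‖b - a‖⁻¹ • (b - a) ∈ vectorSpan ℝ ({a, b, c} : Set E3) := by
  refine ⟨?_, Submodule.smul_mem _ _ (sub_mem_vectorSpan_triple a b c).1⟩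
  rw [norm_smul, norm_inv, norm_norm, inv_mul_cancel₀ (norm_ne_zero_iff.2 (sub_ne_zero.2 hab.symm))]

lemma IsConormal.inner_unit_edge {a b c n : E3}
    (hn : IsConormal n (convexHull ℝ {a, b, c}) (segment ℝ a b)) :
    inner ℝ n (‖b - a‖⁻¹ • (b - a)) = 0 := by
  rw [inner_smul_right, hn.inner_edge (subset_convexHull ℝ _ (by simp))
    (subset_convexHull ℝ _ (by simp)), mul_zero]

/-- Neighbouring triangles of a fine mesh do not fold onto each other, since the projection onto
the surface is injective. -/
lemma inner_conormal_nonpos {Γ U : Set E3} {d : E3 → ℝ} (hΓ : IsSmoothSurface Γ U d) {L : ℝ}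
    (hν : NormalBound Γ (gradient d) L) {σ H : ℝ} {a b c c' : E3} {r δ r' δ' : ℝ}
    (hT : AdmissibleTriangle Γ σ H a b c r δ) (hT' : AdmissibleTriangle Γ σ H a b c' r' δ')
    (hab : a ≠ b) (hκ : 6 * σ * L * H ≤ 1 / 8) (hH : 8 * L * H < 1)
    (hU : convexHull ℝ ({a, b, c} : Set E3) ∪ convexHull ℝ ({a, b, c'} : Set E3) ⊆ U)
    (hinj : InjOn (proj d)
      (convexHull ℝ ({a, b, c} : Set E3) ∪ convexHull ℝ ({a, b, c'} : Set E3)))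
    (hcap : convexHull ℝ ({a, b, c} : Set E3) ∩ convexHull ℝ ({a, b, c'} : Set E3) ⊆
      segment ℝ a b)
    {x y : E3} (hx : IsConormal x (convexHull ℝ {a, b, c}) (segment ℝ a b))
    (hy : IsConormal y (convexHull ℝ {a, b, c'}) (segment ℝ a b)) :
    inner ℝ x y ≤ 0 := by
  by_contra! hpos
  obtain ⟨κ, hκdef⟩ : ∃ κ, 6 * σ * L * H = κ := ⟨_, rfl⟩
  rw [hκdef] at hκ
  obtain ⟨hτ, hτs⟩ := unit_edge (c := c') hab
  have hxτ := hx.inner_unit_edge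
  have hyτ := hy.inner_unit_edge
  set τ : E3 := ‖b - a‖⁻¹ • (b - a) with hτdef
  have hH0 : 0 < H := (norm_pos_iff.2 (sub_ne_zero.2 hab.symm)).trans_le
    ((hT.norm_sub_le b (subset_convexHull ℝ _ (by simp))).trans hT.le)
  have hr := hT.pos
  have hr' := hT'.pos
  -- The displacements from the midpoint have length at most `2 * ε`, hence fit into the half discs
  -- of both triangles; `ε ≤ H` keeps the normal offsets below `2 * H`.
  obtain ⟨ε, hε, hεr, hεr', hεH⟩ : ∃ ε : ℝ, 0 < ε ∧ ε ≤ r / 8 ∧ ε ≤ r' / 8 ∧ ε ≤ H :=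
    ⟨min (r / 8) (min (r' / 8) H), by positivity, min_le_left _ _,
      (min_le_right _ _).trans (min_le_left _ _), (min_le_right _ _).trans (min_le_right _ _)⟩
  set m : E3 := a + (1 / 2 : ℝ) • (b - a) with hm
  have hxs := hx.tangential
  have hys := hy.tangential
  rw [vectorSpan_convexHull] at hxs hys
  -- the test point in the first triangle
  set X : E3 := m + (-ε) • x with hX
  have hXK : X ∈ convexHull ℝ ({a, b, c} : Set E3) := by
    refine hx.mem_convexHull hT.disc hr (Submodule.smul_mem _ _ hxs) ?_ ?_
    · rw [norm_smul, hx.unit, norm_neg, Real.norm_of_nonneg hε.le]; linarith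
    · rw [inner_smul_right, real_inner_self_eq_norm_sq, hx.unit]; linarith
  have hXU : X ∈ U := hU (Or.inl hXK)
  obtain ⟨hXd, hpa⟩ := hΓ.norm_proj_sub_le hXU hT.mem_a ((hT.norm_sub_le X hXK).trans hT.le)
  obtain ⟨s, hs, hXs⟩ := hΓ.exists_eq_proj_add_smul ⟨a, hT.mem_a⟩ hXU
  have hpΓ := hΓ.proj_mem ⟨a, hT.mem_a⟩ hXU
  set p := proj d X with hp
  set n := gradient d p with hn
  have hxν : |inner ℝ x n| ≤ κ := 
    hκdef ▸ hT.abs_inner_le_of_unit hν hpΓ hpa hxs hx.unit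
  have hyν : |inner ℝ y n| ≤ κ := 
    hκdef ▸ hT'.abs_inner_le_of_unit hν hpΓ hpa hys hy.unit
  have hτν : |inner ℝ τ n| ≤ κ := 
    hκdef ▸ hT'.abs_inner_le_of_unit hν hpΓ hpa hτs hτ
  obtain ⟨N, hN, hNdec⟩ := exists_orthonormal_completion hy.unit hτ hyτ
  obtain ⟨h1, h2, h3⟩ := conormal_dichotomy_bounds hκ hy.unit hx.unit hxτ (hν.unit p hpΓ)
    hyν hxν hτν hN
  have hκ0 : 0 ≤ κ := (abs_nonneg _).trans hxν
  have hc2 : 1 / 2 ≤ inner ℝ x y := by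
    have h4 : inner ℝ x N ^ 2 ≤ 16 * κ ^ 2 := by
      have := sq_le_sq' (abs_le.1 h2).1 (abs_le.1 h2).2
      linarith
    have h5 : κ ^ 2 ≤ 1 / 64 := (pow_le_pow_left₀ hκ0 hκ 2).trans (by norm_num)
    refine le_of_sq_le_sq ?_ hpos.le
    linarith
  have hnN : inner ℝ n N ≠ 0 := fun h0 => by
    rw [h0, abs_zero] at h1; linarith
  -- the normal line through `X` meets the plane of the second triangle in `Z`
  set t : ℝ := ε * (inner ℝ x N / inner ℝ n N) with ht
  have htabs : |t| ≤ 8 * κ * ε := by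
    have h4 : |inner ℝ x N| / |inner ℝ n N| ≤ 8 * κ := by
      rw [div_le_iff₀ (by linarith)]
      have := mul_le_mul_of_nonneg_left h1 hκ0
      linarith
    rw [ht, abs_mul, abs_div, abs_of_pos hε, mul_comm]
    exact mul_le_mul_of_nonneg_right h4 hε.le
  have htε : |t| ≤ ε := htabs.trans (mul_le_of_le_one_left hε.le (by linarith))
  set V : E3 := (-ε) • x + t • n with hV
  have hVN : inner ℝ V N = 0 := by
    rw [hV, inner_add_left, inner_smul_left, inner_smul_left, conj_trivial, conj_trivial, ht]
    field_simp; ring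
  have hVs : V ∈ vectorSpan ℝ ({a, b, c'} : Set E3) := by
    rw [hNdec V, hVN, zero_smul, add_zero]
    exact Submodule.add_mem _ (Submodule.smul_mem _ _ hys) (Submodule.smul_mem _ _ hτs)
  have hVn : ‖V‖ ≤ r' / 4 := by
    refine (norm_add_le _ _).trans ?_
    rw [norm_smul, norm_smul, hx.unit, hν.unit p hpΓ, norm_neg, Real.norm_of_nonneg hε.le,
      Real.norm_eq_abs]
    linarith
  have hVy : inner ℝ y V ≤ 0 := by
    rw [hV, inner_add_right, inner_smul_right, inner_smul_right, real_inner_comm x y]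
    have h4 : t * inner ℝ y n ≤ 8 * κ * ε * κ := by
      refine (le_abs_self _).trans ?_
      rw [abs_mul]
      exact mul_le_mul htabs hyν (abs_nonneg _) (by positivity)
    have h5 : κ ^ 2 ≤ 1 / 64 := (pow_le_pow_left₀ hκ0 hκ 2).trans (by norm_num)
    have h6 := mul_le_mul_of_nonneg_left h5 hε.le
    have h7 := mul_le_mul_of_nonneg_left hc2 hε.le
    linarith
  have hZK := hy.mem_convexHull hT'.disc hr' hVs hVn hVy
  rw [← hm] at hZK
  set Z : E3 := m + V with hZ
  have hZX : Z = X + t • n := by rw [hZ, hX, hV]; abel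
  have hZU : Z ∈ U := hU (Or.inr hZK)
  obtain ⟨hZd, -⟩ := hΓ.norm_proj_sub_le hZU hT'.mem_a ((hT'.norm_sub_le Z hZK).trans hT'.le)
  obtain ⟨s', hs', hZs⟩ := hΓ.exists_eq_proj_add_smul ⟨a, hT.mem_a⟩ hZU
  have hp'Γ := hΓ.proj_mem ⟨a, hT.mem_a⟩ hZU
  -- `Z` lies on the normal line at `p` and on the one at its own projection, both at short
  -- distance, so the base points agree.
  have hpp : p = proj d Z := by
    refine hν.eq_of_add_smul_eq hpΓ hp'Γ (s := s + t) (s' := s') (H := H) ?_ ?_ hH ?_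
    · refine (abs_add_le _ _).trans ?_
      rw [hs]; linarith
    · rw [hs']; linarith
    · rw [← hZs, hZX, add_smul, ← add_assoc]
      exact congrArg (· + t • n) hXs.symm
  have hXZ : X = Z := hinj (Or.inl hXK) (Or.inr hZK) hpp
  -- A common point of the two triangles lies on the edge, whereas `X` is at distance `ε` from the
  -- line of the edge.
  obtain ⟨u, v, hu, hv, huv, huX⟩ := hcap ⟨hXK, hXZ ▸ hZK⟩
  have h0 := hx.inner_edge (subset_convexHull ℝ _ (by simp)) (subset_convexHull ℝ _ (by simp))
  have h4 : X - m = (v - 1 / 2) • (b - a) := by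
    obtain rfl : u = 1 - v := by linarith
    rw [← huX, hm]; module
  have h5 : inner ℝ x (X - m) = 0 := by rw [h4, inner_smul_right, h0, mul_zero]
  rw [hX, add_sub_cancel_left, inner_smul_right, real_inner_self_eq_norm_sq, hx.unit] at h5
  linarith

/-- The edge estimate: the two right-hand sides of the edge conditions differ by `O(h²)`. -/
lemma abs_inner_avgConormal_sub_le_of_admissible {Γ U : Set E3} {d : E3 → ℝ}
    (hΓ : IsSmoothSurface Γ U d) {L : ℝ}
    (hν : NormalBound Γ (gradient d) L) {σ H : ℝ} (hσ : 0 < σ) {a b c c' : E3} {r δ r' δ' : ℝ}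
    (hT : AdmissibleTriangle Γ σ H a b c r δ) (hT' : AdmissibleTriangle Γ σ H a b c' r' δ')
    (hab : a ≠ b)
    (hU : convexHull ℝ ({a, b, c} : Set E3) ∪ convexHull ℝ ({a, b, c'} : Set E3) ⊆ U)
    (hinj : InjOn (proj d)
      (convexHull ℝ ({a, b, c} : Set E3) ∪ convexHull ℝ ({a, b, c'} : Set E3)))
    (hcap : convexHull ℝ ({a, b, c} : Set E3) ∩ convexHull ℝ ({a, b, c'} : Set E3) ⊆
      segment ℝ a b)
    {x y : E3} (hx : IsConormal x (convexHull ℝ {a, b, c}) (segment ℝ a b))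
    (hy : IsConormal y (convexHull ℝ {a, b, c'}) (segment ℝ a b))
    {w : E3 → E3} {M : ℝ} (hw : ∀ x ∈ Γ, inner ℝ (w x) (gradient d x) = 0)
    (hM : ∀ x ∈ Γ, ‖w x‖ ≤ M) {z : E3} (hz : z ∈ segment ℝ a b) :
    |inner ℝ (invLift d w z) (avgConormal x y - x)| ≤
      (24 * (6 * σ * L) ^ 2 + 2 * (48 * σ * L + 16 * L) ^ 2) * M * H ^ 2 := by
  have hL := hν.pos
  have hH0 : 0 < H := (norm_pos_iff.2 (sub_ne_zero.2 hab.symm)).trans_le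
    ((hT.norm_sub_le b (subset_convexHull ℝ _ (by simp))).trans hT.le)
  have hM0 : 0 ≤ M := (norm_nonneg _).trans (hM a hT.mem_a)
  have hzK : z ∈ convexHull ℝ ({a, b, c} : Set E3) :=
    segment_subset_convexHull (by simp) (by simp) hz
  have hzU : z ∈ U := hU (Or.inl hzK)
  obtain ⟨-, hpa⟩ := hΓ.norm_proj_sub_le hzU hT.mem_a ((hT.norm_sub_le z hzK).trans hT.le)
  have hpΓ := hΓ.proj_mem ⟨a, hT.mem_a⟩ hzU
  have hA : 0 ≤ 24 * (6 * σ * L) ^ 2 * M * H ^ 2 := by positivity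
  have hB : 0 ≤ 2 * (48 * σ * L + 16 * L) ^ 2 * M * H ^ 2 := by positivity
  -- The threshold gives both `6 * σ * L * H ≤ 1 / 8` and `8 * L * H < 1`. Above it, `2 * M` is at
  -- most `2 * M` times the square of the left-hand side.
  by_cases hsmall : (48 * σ * L + 16 * L) * H ≤ 1
  · have hσLH : 0 < σ * L * H := by positivity
    have hLH : 0 < L * H := by positivity
    have hκ : 6 * σ * L * H ≤ 1 / 8 := by nlinarith
    have hopp := inner_conormal_nonpos hΓ hν hT hT' hab hκ (by nlinarith) hU hinj hcap hx hy
    have hxs := hx.tangential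
    have hys := hy.tangential
    rw [vectorSpan_convexHull] at hxs hys
    obtain ⟨hτ, hτs⟩ := unit_edge (c := c) hab
    have := abs_inner_avgConormal_sub_le hκ hx.unit hy.unit hτ hx.inner_unit_edge
      hy.inner_unit_edge (hν.unit _ hpΓ)
      (hT.abs_inner_le_of_unit hν hpΓ hpa hxs hx.unit)
      (hT'.abs_inner_le_of_unit hν hpΓ hpa hys hy.unit)
      (hT.abs_inner_le_of_unit hν hpΓ hpa hτs hτ)
      (by rwa [real_inner_comm]) (hw _ hpΓ) (hM _ hpΓ)
    calc _ ≤ 24 * (6 * σ * L * H) ^ 2 * M := this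
      _ ≤ _ := by linarith
  · push Not at hsmall
    have h1 : 1 ≤ ((48 * σ * L + 16 * L) * H) ^ 2 := one_le_pow₀ hsmall.le
    calc _ ≤ ‖invLift d w z‖ * ‖avgConormal x y - x‖ := abs_real_inner_le_norm _ _
      _ ≤ M * (1 + 1) := by
          gcongr
          · exact hM _ hpΓ
          · exact (norm_sub_le _ _).trans (add_le_add (norm_avgConormal_le_one x y) hx.unit.le)
      _ ≤ M * 2 * ((48 * σ * L + 16 * L) * H) ^ 2 := by
          have : 0 ≤ M * 2 := by positivity
          nlinarith
      _ ≤ _ := by linarith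

/-! ### Combinatorics of the mesh -/

/-- The order lists the end points of the edge `i` first, as the lemmas on `{a, b, c}` with edge `a
b` require. -/
lemma range_eq_triple (v : Fin 3 → E3) (i : Fin 3) :
    range v = {v (i + 1), v (i + 2), v i} := by
  ext x
  simp only [mem_range, Fin.exists_fin_succ, mem_insert_iff, mem_singleton_iff]
  fin_cases i <;> simp [eq_comm] <;> tauto

lemma not_collinear_of_mem_triangles {𝒯 : Geometry.SimplicialComplex ℝ E3} {s : Finset E3}
    (hs : s ∈ triangles 𝒯) : ¬ Collinear ℝ (s : Set E3) := by
  have h := 𝒯.indep hs.1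
  have e : Fin 3 ≃ s := (finCongr hs.2.symm).trans s.equivFin.symm
  have h3 := h.comp_embedding e.toEmbedding
  rw [affineIndependent_iff_not_collinear] at h3
  suffices h4 : (s : Set E3) = range (((↑) : s → E3) ∘ e.toEmbedding) by rwa [h4]
  ext x
  constructor
  · intro hx
    exact ⟨e.symm ⟨x, hx⟩, by simp⟩
  · rintro ⟨i, rfl⟩
    exact (e i).2

/-- The radius is chosen before the labelling of the vertices, so that one `r` serves all three
edges. -/
lemma IsSurfaceMesh.admissibleTriangle {Γ U : Set E3} {d : E3 → ℝ} {σ : ℝ}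
    {𝒯 : Geometry.SimplicialComplex ℝ E3} (h𝒯 : IsSurfaceMesh Γ U d σ 𝒯) {s : Finset E3}
    (hs : s ∈ triangles 𝒯) : ∃ r, ∀ a b c : E3, (s : Set E3) = {a, b, c} →
      AdmissibleTriangle Γ σ (meshSize 𝒯) a b c r (Metric.diam (hull s)) := by
  obtain ⟨x, hx, r, hr, hdiam, hball⟩ := h𝒯.shapeRegular s hs
  refine ⟨r, fun a b c habc => ?_⟩
  have hv := h𝒯.vertices s hs.1
  have hfin : (triangles 𝒯).Finite := h𝒯.finite.subset fun s hs => hs.1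
  refine ⟨hv (by simp [habc]), hv (by simp [habc]), hv (by simp [habc]), hr,
    ⟨x, by rwa [← habc], by rwa [← habc]⟩, fun y hy => ?_, hdiam, ?_⟩
  · rw [← habc] at hy
    rw [← dist_eq_norm]
    exact Metric.dist_le_diam_of_mem
      ((s.finite_toSet.isCompact_convexHull (𝕜 := ℝ)).isBounded) hy
      (subset_convexHull ℝ _ (by simp [habc]))
  · exact le_csSup (hfin.image _).bddAbove ⟨s, hs, rfl⟩

/-- Every edge of a triangle belongs to a second triangle. -/
lemma IsSurfaceMesh.exists_neighbour {Γ U : Set E3} {d : E3 → ℝ} {σ : ℝ}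
    {𝒯 : Geometry.SimplicialComplex ℝ E3} (h𝒯 : IsSurfaceMesh Γ U d σ 𝒯) {s : Finset E3}
    (hs : s ∈ triangles 𝒯) {a b c : E3} (habc : (s : Set E3) = {a, b, c}) (hab : a ≠ b) :
    ∃ s' ∈ triangles 𝒯, s' ≠ s ∧ a ∈ s' ∧ b ∈ s' ∧ ∃ c', (s' : Set E3) = {a, b, c'} ∧
      hull s ∩ hull s' ⊆ segment ℝ a b := by
  classical
  have hes : ({a, b} : Finset E3) ⊆ s := by
    intro x hx
    rw [← Finset.mem_coe, habc]
    simp only [Finset.mem_insert, Finset.mem_singleton] at hx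
    rcases hx with rfl | rfl <;> simp
  have hcard : ({a, b} : Finset E3).card = 2 := Finset.card_pair hab
  have he := 𝒯.down_closed hs.1 hes ⟨a, by simp⟩
  obtain ⟨s', hs', hne⟩ := exists_ne_of_one_lt_ncard
    (by rw [h𝒯.two_triangles _ he hcard]; norm_num) s
  have hes' : ({a, b} : Finset E3) ⊆ s' := hs'.2
  refine ⟨s', hs'.1, hne, hes' (by simp), hes' (by simp), ?_⟩
  obtain ⟨c', hc'⟩ := Finset.card_eq_one.1 (show (s' \ {a, b}).card = 1 by
    rw [Finset.card_sdiff_of_subset hes', hcard, hs'.1.2])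
  have hset' : (s' : Set E3) = {a, b, c'} := by
    rw [← Finset.union_sdiff_of_subset hes', hc']
    ext x; simp
  refine ⟨c', hset', ?_⟩
  refine (𝒯.inter_subset_convexHull hs.1 hs'.1.1).trans ?_
  rw [← convexHull_pair]
  refine convexHull_mono ?_
  rintro x ⟨hx, hx'⟩
  -- A common vertex off the edge would be `c`, and then all three vertices would be shared.
  by_contra hxab
  have hxc : x = c := by
    rw [habc] at hx
    simp only [mem_insert_iff, mem_singleton_iff] at hx hxab
    tauto
  refine hne (Finset.eq_of_subset_of_card_le ?_ (by rw [hs.2, hs'.1.2])).symm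
  intro z hz
  rw [← Finset.mem_coe, habc] at hz
  rcases hz with rfl | rfl | rfl
  · exact hes' (by simp)
  · exact hes' (by simp)
  · exact hxc ▸ hx'

/-- Estimate of the difference of the conormals on all edges of the mesh. -/
lemma exists_edge_bound {Γ U : Set E3} {d : E3 → ℝ} (hΓ : IsSmoothSurface Γ U d) (σ : ℝ) :
    ∃ C : ℝ, ∀ 𝒯 : Geometry.SimplicialComplex ℝ E3, IsSurfaceMesh Γ U d σ 𝒯 →
      ∀ (w : E3 → E3) (M : ℝ), (∀ x ∈ Γ, inner ℝ (w x) (gradient d x) = 0) →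
      (∀ x ∈ Γ, ‖w x‖ ≤ M) → ∀ s ∈ triangles 𝒯, ∀ a b c : E3, (s : Set E3) = {a, b, c} → a ≠ b →
      ∃ np, IsConormal np (convexHull ℝ {a, b, c}) (segment ℝ a b) ∧
      ∃ s' ∈ triangles 𝒯, s' ≠ s ∧ a ∈ s' ∧ b ∈ s' ∧
      ∃ nm, IsConormal nm (hull s') (segment ℝ a b) ∧
      ∀ z ∈ segment ℝ a b,
        |inner ℝ (invLift d w z) (avgConormal np nm - np)| ≤ C * M * meshSize 𝒯 ^ 2 := by
  obtain ⟨L, hν⟩ := hΓ.exists_normalBound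
  refine ⟨24 * (6 * σ * L) ^ 2 + 2 * (48 * σ * L + 16 * L) ^ 2, ?_⟩
  intro 𝒯 h𝒯 w M hw hM s hs a b c habc hab
  obtain ⟨r, hr⟩ := h𝒯.admissibleTriangle hs
  have hT := hr a b c habc
  obtain ⟨s', hs', hne, ha', hb', c', hset', hcap⟩ := h𝒯.exists_neighbour hs habc hab
  obtain ⟨r', hr'⟩ := h𝒯.admissibleTriangle hs'
  have hT' := hr' a b c' hset'
  obtain ⟨np, hnp⟩ := exists_isConormal (habc ▸ not_collinear_of_mem_triangles hs)
  obtain ⟨nm, hnm⟩ := exists_isConormal (hset' ▸ not_collinear_of_mem_triangles hs')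
  -- Positivity of `σ` follows from the existence of a triangle: `0 < ‖b - a‖ ≤ σ * r`.
  have hσ : 0 < σ := by
    have h1 := hT.norm_sub_le b (subset_convexHull ℝ _ (by simp))
    have h2 : 0 < ‖b - a‖ := norm_pos_iff.2 (sub_ne_zero.2 hab.symm)
    exact pos_of_mul_pos_left (h2.trans_le (h1.trans hT.le_mul)) hT.pos.le
  have hspace : convexHull ℝ ({a, b, c} : Set E3) ∪ convexHull ℝ ({a, b, c'} : Set E3) ⊆
      𝒯.space := by
    rw [← habc, ← hset']
    exact union_subset (𝒯.convexHull_subset_space hs.1) (𝒯.convexHull_subset_space hs'.1)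
  refine ⟨np, hnp, s', hs', hne, ha', hb', nm, by rwa [hull, hset'], fun z hz => ?_⟩
  refine abs_inner_avgConormal_sub_le_of_admissible hΓ hν hσ hT hT' hab
    (hspace.trans h𝒯.subset) (h𝒯.bijOn.injOn.mono hspace) ?_ hnp hnm hw hM hz
  rwa [hull, hull, habc, hset'] at hcap

/-! ### The Piola transform -/

lemma gradRefMap_add (v : Fin 3 → E3) (p p' : Fin 2 → ℝ) :
    gradRefMap v (p + p') = gradRefMap v p + gradRefMap v p' := by
  simp only [gradRefMap, Pi.add_apply]; module

lemma gradRefMap_sub (v : Fin 3 → E3) (p p' : Fin 2 → ℝ) :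
    gradRefMap v (p - p') = gradRefMap v p - gradRefMap v p' := by
  simp only [gradRefMap, Pi.sub_apply]; module

lemma gradRefMap_smul (v : Fin 3 → E3) (c : ℝ) (p : Fin 2 → ℝ) :
    gradRefMap v (c • p) = c • gradRefMap v p := by
  simp only [gradRefMap, Pi.smul_apply, smul_eq_mul]; module

lemma refMap_sub (v : Fin 3 → E3) (y : Fin 2 → ℝ) : refMap v y - v 0 = gradRefMap v y := by
  simp only [refMap, gradRefMap]; abel

lemma continuous_gradRefMap_evalPair (v : Fin 3 → E3) (p : Fin 2 → MvPolynomial (Fin 2) ℝ) :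
    Continuous fun y => gradRefMap v (evalPair p y) := by
  have := fun P : MvPolynomial (Fin 2) ℝ => MvPolynomial.continuous_eval P
  simp only [gradRefMap, evalPair]
  fun_prop

/-- Since `x - x₀ = ∇F y`, the term `(x - x₀) t` is the image of `y t`. -/
lemma MemRT.exists_eq {q : ℕ} {v : Fin 3 → E3} {ψ : E3 → E3} (h : MemRT q v ψ) :
    ∃ (p : Fin 2 → MvPolynomial (Fin 2) ℝ) (t : MvPolynomial (Fin 2) ℝ),
      (∀ j, (p j).totalDegree ≤ q) ∧ t.totalDegree ≤ q ∧
      ∀ y ∈ refTriangle, ψ (refMap v y) =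
        gradRefMap v (evalPair (fun j => p j + MvPolynomial.X j * t) y) := by
  obtain ⟨p, t, hp, ht, h⟩ := h
  refine ⟨p, t, hp, ht, fun y hy => ?_⟩
  rw [h y hy, refMap_sub, ← gradRefMap_smul, ← gradRefMap_add]
  congr 1
  funext j
  simp [evalPair, mul_comm]

lemma lineMap_eq_refMap (v : Fin 3 → E3) (i : Fin 3) (t : ℝ) :
    AffineMap.lineMap (v (i + 1)) (v (i + 2)) t = refMap v (refEdge i t) := by
  rw [AffineMap.lineMap_apply_module]
  fin_cases i <;> simp [refMap, refEdge] <;> module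

/-- The normal component of a transformed field on an edge. -/
lemma inner_gradRefMap_conormal {v : Fin 3 → E3} {i : Fin 3} {n : E3}
    (hn : inner ℝ n (v (i + 2) - v (i + 1)) = 0) (p : Fin 2 → ℝ) :
    inner ℝ (gradRefMap v p) n =
      -inner ℝ n (v i - v (i + 1)) * ∑ j, p j * refNormal i j := by
  rw [real_inner_comm, gradRefMap, inner_add_right, inner_smul_right, inner_smul_right,
    Fin.sum_univ_two]
  fin_cases i <;>
    simp [refNormal, inner_sub_right] at hn ⊢
  · linear_combination p 1 * hn
  · linear_combination (-p 0 - p 1) * hn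
  · linear_combination p 0 * hn

lemma mem_convexHull_range_iff {v : Fin 3 → E3} {x : E3} :
    x ∈ convexHull ℝ (range v) ↔ ∃ y ∈ refTriangle, x = refMap v y := by
  have : range v = {v 0, v 1, v 2} := by simpa using range_eq_triple v 2
  rw [this, mem_convexHull_triple]
  constructor
  · rintro ⟨s, t, hs, ht, hst, rfl⟩
    exact ⟨![s, t], ⟨by simpa using hs, by simpa using ht, by simpa using hst⟩, by simp [refMap]⟩
  · rintro ⟨y, ⟨h0, h1, h2⟩, rfl⟩
    exact ⟨y 0, y 1, h0, h1, h2, rfl⟩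

/-- The Gram determinant of a non-degenerate triangle is positive. -/
lemma gram_pos {a b c : E3} (h : ¬ Collinear ℝ ({a, b, c} : Set E3)) :
    0 < ‖b - a‖ ^ 2 * ‖c - a‖ ^ 2 - inner ℝ (b - a) (c - a) ^ 2 := by
  set e := b - a with he
  set f := c - a with hf
  have hab : e ≠ 0 := by
    intro h0
    rw [he, sub_eq_zero] at h0
    apply h
    rw [h0]
    simpa using collinear_pair ℝ a c
  have hpos : 0 < ‖e‖ ^ 2 := by positivity
  -- The squared norm of this vector is `‖e‖ ^ 2` times the Gram determinant.
  have hne : ‖e‖ ^ 2 • f - inner ℝ e f • e ≠ 0 := by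
    intro h0
    apply h
    rw [collinear_iff_of_mem (p₀ := a) (by simp)]
    refine ⟨e, ?_⟩
    rintro p (rfl | rfl | rfl)
    · exact ⟨0, by simp⟩
    · exact ⟨1, by simp [he]⟩
    · refine ⟨(‖e‖ ^ 2)⁻¹ * inner ℝ e f, ?_⟩
      rw [mul_smul, ← sub_eq_zero.1 h0, inv_smul_smul₀ hpos.ne', hf]
      simp
  have h1 : 0 < ‖‖e‖ ^ 2 • f - inner ℝ e f • e‖ ^ 2 := by positivity
  rw [norm_sub_sq_real, norm_smul, norm_smul, inner_smul_left, inner_smul_right,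
    real_inner_comm e f, mul_pow, mul_pow, Real.norm_eq_abs, Real.norm_eq_abs, sq_abs, sq_abs] at h1
  simp only [conj_trivial] at h1
  refine pos_of_mul_pos_right (a := ‖e‖ ^ 2) ?_ hpos.le
  nlinarith

/-- Vanishing interior moments on the triangle give vanishing interior moments on the reference
triangle. -/
lemma refInterior_moments_eq_zero {q : ℕ} {v : Fin 3 → E3}
    (hv : ¬ Collinear ℝ ({v 0, v 1, v 2} : Set E3)) {ψ ψc f : E3 → E3}
    (hψ : InteriorMomentsEq q v ψ f) (hψc : InteriorMomentsEq q v ψc f)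
    {Φ Φc : Fin 2 → MvPolynomial (Fin 2) ℝ}
    (hΦ : ∀ y ∈ refTriangle, ψ (refMap v y) = gradRefMap v (evalPair Φ y))
    (hΦc : ∀ y ∈ refTriangle, ψc (refMap v y) = gradRefMap v (evalPair Φc y))
    (u : Fin 2 → MvPolynomial (Fin 2) ℝ) (hu : ∀ j, (u j).totalDegree < q) :
    ∫ y in refTriangle, ∑ j, MvPolynomial.eval y (Φ j - Φc j) * MvPolynomial.eval y (u j) = 0 := by
  have hg := gram_pos hv
  set g : ℝ := ‖v 1 - v 0‖ ^ 2 * ‖v 2 - v 0‖ ^ 2 - inner ℝ (v 1 - v 0) (v 2 - v 0) ^ 2 with hgdef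
  set g11 : ℝ := ‖v 1 - v 0‖ ^ 2 with hg11
  set g22 : ℝ := ‖v 2 - v 0‖ ^ 2 with hg22
  set g12 : ℝ := inner ℝ (v 1 - v 0) (v 2 - v 0) with hg12
  -- The adjugate of the Gram matrix applied to `u`: the inner product of `∇F Ψ` with `∇F p` is then
  -- `g` times that of `Ψ` with `u`.
  set p : Fin 2 → MvPolynomial (Fin 2) ℝ := ![g22 • u 0 - g12 • u 1, g11 • u 1 - g12 • u 0] with hp
  have hdeg : ∀ j, (p j).totalDegree < q := by
    have h : ∀ (α β : ℝ) (i j : Fin 2), (α • u i - β • u j).totalDegree < q := fun α β i j =>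
      (MvPolynomial.totalDegree_sub _ _).trans_lt (max_lt
        ((MvPolynomial.totalDegree_smul_le _ _).trans_lt (hu i))
        ((MvPolynomial.totalDegree_smul_le _ _).trans_lt (hu j)))
    intro j
    fin_cases j
    · exact h _ _ _ _
    · exact h _ _ _ _
  have h1 := (hψ p hdeg).trans (hψc p hdeg).symm
  simp only [triangleIntegral] at h1
  have h2 := mul_left_cancel₀ (Real.sqrt_pos.2 hg).ne' h1
  have hcongr : ∀ (χ : E3 → E3) (Ψ : Fin 2 → MvPolynomial (Fin 2) ℝ),
      (∀ y ∈ refTriangle, χ (refMap v y) = gradRefMap v (evalPair Ψ y)) →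
      ∫ y in refTriangle, inner ℝ (χ (refMap v y)) (gradRefMap v (evalPair p y)) =
        ∫ y in refTriangle, inner ℝ (gradRefMap v (evalPair Ψ y)) (gradRefMap v (evalPair p y)) :=
    fun χ Ψ h => setIntegral_congr_fun isCompact_refTriangle.measurableSet
      fun y hy => by simp only [h y hy]
  rw [hcongr ψ Φ hΦ, hcongr ψc Φc hΦc, ← sub_eq_zero, ← integral_sub] at h2
  · refine (mul_eq_zero.1 ?_).resolve_left hg.ne'
    rw [← h2, ← integral_const_mul]
    refine integral_congr_ae (Filter.Eventually.of_forall fun y => ?_)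
    simp only
    rw [← inner_sub_left, ← gradRefMap_sub]
    simp only [gradRefMap, inner_add_left, inner_add_right, inner_smul_left, inner_smul_right,
      real_inner_self_eq_norm_sq, conj_trivial, real_inner_comm (v 1 - v 0) (v 2 - v 0),
      ← hg11, ← hg22, ← hg12, hgdef, evalPair, Pi.sub_apply, Fin.sum_univ_two, hp,
      Matrix.cons_val_zero, Matrix.cons_val_one, map_sub, MvPolynomial.smul_eval]
    ring
  · exact ((continuous_gradRefMap_evalPair v Φ).inner
      (continuous_gradRefMap_evalPair v p)).continuousOn.integrableOn_compact isCompact_refTriangle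
  · exact ((continuous_gradRefMap_evalPair v Φc).inner
      (continuous_gradRefMap_evalPair v p)).continuousOn.integrableOn_compact isCompact_refTriangle

/-- The edge moments of the difference of the interpolants on the reference triangle. -/
lemma abs_refEdgeMoment_sub_le {q : ℕ} {v : Fin 3 → E3} {i : Fin 3} {r G : ℝ} (hr : 0 < r)
    {ψ ψc f : E3 → E3} {n m : E3} (hvi : v (i + 1) ≠ v (i + 2))
    (hn : inner ℝ n (v (i + 2) - v (i + 1)) = 0) (hheight : r ≤ -inner ℝ n (v i - v (i + 1)))
    (hf : ContinuousOn f (segment ℝ (v (i + 1)) (v (i + 2))))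
    (hG : ∀ z ∈ segment ℝ (v (i + 1)) (v (i + 2)), |inner ℝ (f z) (m - n)| ≤ G)
    (hψ : EdgeMomentsEq q (v (i + 1)) (v (i + 2)) ψ n f m)
    (hψc : EdgeMomentsEq q (v (i + 1)) (v (i + 2)) ψc n f n)
    {Φ Φc : Fin 2 → MvPolynomial (Fin 2) ℝ}
    (hΦ : ∀ y ∈ refTriangle, ψ (refMap v y) = gradRefMap v (evalPair Φ y))
    (hΦc : ∀ y ∈ refTriangle, ψc (refMap v y) = gradRefMap v (evalPair Φc y))
    {k : ℕ} (hk : k ≤ q) :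
    |refEdgeMoment (fun j => Φ j - Φc j) i k| ≤ r⁻¹ * G := by
  have hlen : ‖v (i + 2) - v (i + 1)‖ ≠ 0 := norm_ne_zero_iff.2 (sub_ne_zero.2 hvi.symm)
  have hdeg : (Polynomial.X ^ k : Polynomial ℝ).natDegree ≤ q := by
    rw [Polynomial.natDegree_X_pow]; exact hk
  have e1 := mul_left_cancel₀ hlen (hψ _ hdeg)
  have e2 := mul_left_cancel₀ hlen (hψc _ hdeg)
  simp only [Polynomial.eval_pow, Polynomial.eval_X] at e1 e2
  set κ := -inner ℝ n (v i - v (i + 1)) with hκ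
  have hpoly : ∀ (χ : E3 → E3) (Ψ : Fin 2 → MvPolynomial (Fin 2) ℝ),
      (∀ y ∈ refTriangle, χ (refMap v y) = gradRefMap v (evalPair Ψ y)) →
      ∫ t in (0 : ℝ)..1, inner ℝ (χ (AffineMap.lineMap (v (i + 1)) (v (i + 2)) t)) n * t ^ k =
        κ * refEdgeMoment Ψ i k := by
    intro χ Ψ h
    rw [refEdgeMoment, ← intervalIntegral.integral_const_mul]
    refine intervalIntegral.integral_congr fun t ht => ?_
    rw [uIcc_of_le zero_le_one] at ht
    rw [lineMap_eq_refMap, h _ (refEdge_mem i ht), inner_gradRefMap_conormal hn, mul_assoc]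
    rfl
  have hsub : refEdgeMoment (fun j => Φ j - Φc j) i k =
      refEdgeMoment Φ i k - refEdgeMoment Φc i k := by
    simp only [refEdgeMoment]
    rw [← intervalIntegral.integral_sub
      ((continuous_edge_integrand _ _ _).intervalIntegrable _ _)
      ((continuous_edge_integrand _ _ _).intervalIntegrable _ _)]
    simp only [map_sub, sub_mul, Finset.sum_sub_distrib]
  have hmem : ∀ t ∈ Icc (0 : ℝ) 1,
      (AffineMap.lineMap (v (i + 1)) (v (i + 2)) t : E3) ∈ segment ℝ (v (i + 1)) (v (i + 2)) := by
    intro t ht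
    rw [segment_eq_image_lineMap]
    exact ⟨t, ht, rfl⟩
  have hint : ∀ l : E3, IntervalIntegrable (fun t : ℝ =>
      inner ℝ (f (AffineMap.lineMap (v (i + 1)) (v (i + 2)) t)) l * t ^ k) volume 0 1 := by
    intro l
    refine ContinuousOn.intervalIntegrable ?_
    rw [uIcc_of_le zero_le_one]
    have h1 : ContinuousOn (fun t : ℝ => f (AffineMap.lineMap (v (i + 1)) (v (i + 2)) t))
        (Icc 0 1) := hf.comp (AffineMap.lineMap_continuous.continuousOn) hmem
    exact (h1.inner continuousOn_const).mul (by fun_prop)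
  -- Subtracting the two edge conditions leaves only the change of conormal; `κ` is the height over
  -- the edge.
  have hkey : κ * refEdgeMoment (fun j => Φ j - Φc j) i k =
      ∫ t in (0 : ℝ)..1,
        inner ℝ (f (AffineMap.lineMap (v (i + 1)) (v (i + 2)) t)) (m - n) * t ^ k := by
    rw [hsub, mul_sub, ← hpoly ψ Φ hΦ, ← hpoly ψc Φc hΦc, e1, e2,
      ← intervalIntegral.integral_sub (hint m) (hint n)]
    simp only [inner_sub_right, sub_mul]
  have hbd : |κ * refEdgeMoment (fun j => Φ j - Φc j) i k| ≤ G := by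
    rw [hkey, ← Real.norm_eq_abs]
    have := intervalIntegral.norm_integral_le_of_norm_le_const (a := (0 : ℝ)) (b := 1) (C := G)
      (f := fun t => inner ℝ (f (AffineMap.lineMap (v (i + 1)) (v (i + 2)) t)) (m - n) * t ^ k)
      (fun t ht => by
        rw [uIoc_of_le zero_le_one] at ht
        have h1 := hG _ (hmem t ⟨ht.1.le, ht.2⟩)
        rw [norm_mul, Real.norm_eq_abs, norm_pow, Real.norm_of_nonneg ht.1.le]
        exact (mul_le_of_le_one_right (abs_nonneg _) (pow_le_one₀ ht.1.le ht.2)).trans h1)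
    simpa using this
  rw [abs_mul, abs_of_pos (hr.trans_le hheight)] at hbd
  rw [inv_mul_eq_div, le_div_iff₀ hr, mul_comm]
  exact (mul_le_mul_of_nonneg_right hheight (abs_nonneg _)).trans hbd

end SurfaceRT

/-! ### Assembly of the estimate -/

open SurfaceRT in
theorem mainTheorem5 (Γ U : Set SurfaceRT.E3) (d : SurfaceRT.E3 → ℝ)
    (hΓ : SurfaceRT.IsSmoothSurface Γ U d) (σ : ℝ) (q : ℕ) :
    ∃ C : ℝ, ∀ 𝒯 : Geometry.SimplicialComplex ℝ SurfaceRT.E3,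
      SurfaceRT.IsSurfaceMesh Γ U d σ 𝒯 →
      ∀ (w : SurfaceRT.E3 → SurfaceRT.E3) (M : ℝ),
        (∀ x ∈ Γ, inner ℝ (w x) (gradient d x) = 0) →
        (∀ x ∈ Γ, ‖w x‖ ≤ M) →
        SurfaceRT.MemW1Inf 𝒯 (SurfaceRT.invLift d w) →
        ∀ v : Fin 3 → SurfaceRT.E3, Function.Injective v →
          Finset.univ.image v ∈ SurfaceRT.triangles 𝒯 →
          ∀ ψ ψc : SurfaceRT.E3 → SurfaceRT.E3,
            SurfaceRT.IsSurfaceRTInterpolant 𝒯 q v (SurfaceRT.invLift d w) ψ →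
            SurfaceRT.IsClassicalRTInterpolant q v (SurfaceRT.invLift d w) ψc →
            ∀ x ∈ convexHull ℝ (Set.range v),
              ‖ψ x - ψc x‖ ≤ C * M * SurfaceRT.meshSize 𝒯 ^ 2 := by
  obtain ⟨C, hC⟩ := exists_edge_bound hΓ σ
  obtain ⟨R, hR⟩ := exists_ref_bound q
  -- Two components, each at most `R * (r⁻¹ * G)`, multiply edge vectors of length at most `σ * r`.
  refine ⟨2 * σ * R * C, ?_⟩
  intro 𝒯 h𝒯 w M hw hM hW v hv hs ψ ψc hψ hψc x hx
  obtain ⟨hψRT, hψint, hψedge⟩ := hψ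
  obtain ⟨hψcRT, hψcint, hψcedge⟩ := hψc
  obtain ⟨p, t, hp, ht, hΦ⟩ := hψRT.exists_eq
  obtain ⟨pc, tc, hpc, htc, hΦc⟩ := hψcRT.exists_eq
  have hset : ∀ i, ((Finset.univ.image v : Finset E3) : Set E3) = {v (i + 1), v (i + 2), v i} := by
    intro i
    rw [← range_eq_triple]; simp
  have hset0 : ((Finset.univ.image v : Finset E3) : Set E3) = {v 0, v 1, v 2} := by
    simpa using hset 2
  obtain ⟨r, hr⟩ := h𝒯.admissibleTriangle hs
  have hT := hr _ _ _ hset0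
  have hr0 := hT.pos
  set Φ : Fin 2 → MvPolynomial (Fin 2) ℝ := fun j => p j + MvPolynomial.X j * t with hΦdef
  set Φc : Fin 2 → MvPolynomial (Fin 2) ℝ := fun j => pc j + MvPolynomial.X j * tc with hΦcdef
  set G := C * M * meshSize 𝒯 ^ 2 with hGdef
  have hmem : (fun j => Φ j - Φc j) ∈ refBubbleFree q := by
    refine ⟨⟨fun j => p j - pc j, t - tc, fun j => (MvPolynomial.totalDegree_sub _ _).trans
      (max_le (hp j) (hpc j)), (MvPolynomial.totalDegree_sub _ _).trans (max_le ht htc),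
      fun j => ?_⟩, fun u hu => ?_⟩
    · simp only [hΦdef, hΦcdef]; ring
    · exact refInterior_moments_eq_zero (hset0 ▸ not_collinear_of_mem_triangles hs) hψint hψcint
        hΦ hΦc u hu
  have hedge : ∀ i, ∀ k ≤ q, |refEdgeMoment (fun j => Φ j - Φc j) i k| ≤ r⁻¹ * G := by
    intro i k hk
    have hvi : v (i + 1) ≠ v (i + 2) := fun h => by
      have := hv h
      revert this; fin_cases i <;> decide
    obtain ⟨np, hnp, s', hs', hne, ha', hb', nm, hnm, hbd⟩ :=
      hC 𝒯 h𝒯 w M hw hM _ hs _ _ _ (hset i) hvi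
    have hnp' := hnp
    rw [← range_eq_triple] at hnp'
    have hsub := subset_convexHull ℝ ({v (i + 1), v (i + 2), v i} : Set E3)
    refine abs_refEdgeMoment_sub_le hr0 hvi (hnp.inner_edge (hsub (by simp)) (hsub (by simp)))
      (hnp.le_height (hr _ _ _ (hset i)).disc hr0) (hW.1.mono ?_) hbd
      (hψedge i s' hs' hne ha' hb' np nm hnp' hnm) (hψcedge i np hnp') hΦ hΦc hk
    refine Set.Subset.trans ?_ (𝒯.convexHull_subset_space hs.1)
    rw [hset i]
    exact segment_subset_convexHull (by simp) (by simp)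
  obtain ⟨y, hy, rfl⟩ := mem_convexHull_range_iff.1 hx
  have hb := hR _ hmem _ hedge y hy
  have h1 := hT.norm_sub_le (v 1) (subset_convexHull ℝ _ (by simp))
  have h2 := hT.norm_sub_le (v 2) (subset_convexHull ℝ _ (by simp))
  -- No sign of `R` or `C` is known separately; the product is nonnegative because it bounds an
  -- absolute value.
  have hG0 : 0 ≤ R * (r⁻¹ * G) := (abs_nonneg _).trans (hb 0)
  rw [hΦ y hy, hΦc y hy, ← gradRefMap_sub]
  calc ‖gradRefMap v (evalPair Φ y - evalPair Φc y)‖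
      ≤ R * (r⁻¹ * G) * (σ * r) + R * (r⁻¹ * G) * (σ * r) := by
        refine (norm_add_le _ _).trans (add_le_add ?_ ?_)
        · rw [norm_smul, Real.norm_eq_abs]
          refine mul_le_mul ?_ (h1.trans hT.le_mul) (norm_nonneg _) hG0
          simpa [evalPair] using hb 0
        · rw [norm_smul, Real.norm_eq_abs]
          refine mul_le_mul ?_ (h2.trans hT.le_mul) (norm_nonneg _) hG0
          simpa [evalPair] using hb 1
    _ = 2 * σ * R * C * M * meshSize 𝒯 ^ 2 := by
        rw [hGdef]; field_simp; ring
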